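/- Let $1<p<\infty$ and let $\omega$ be a rational complex function, $\omega\not\equiv 0$. Here $\mathbb D$ is the open unit disc, $\mathbb T$ the unit circle, $H^p\subset L^p=L^p(\mathbb T)$ the Hardy space, i.e. the functions in $L^p$ whose Fourier coefficients with negative index vanish, and $\mathbb P$ the Riesz projection, i.e. the projection of $L^p$ onto $H^p$ along the functions in $L^p$ whose Fourier coefficients with non-negative index vanish. $\mathrm{Rat}(\mathbb T)$ is the set of rational functions with all poles on $\mathbb T$, and $\mathrm{Rat}_0(\mathbb T)$ the set of strictly proper functions in $\mathrm{Rat}(\mathbb T)$; poles and zeros at infinity are not counted. For a rational function $\psi$ let $T_\psi$ be the operator in $H^p$ with $$\mathrm{Dom}(T_\psi)=\{g\in H^p : \psi g=f+\rho \text{ with } f\in L^p,\ \rho\in\mathrm{Rat}_0(\mathbb T)\},\qquad T_\psi g=\mathbb P f .$$ Let $\kappa=l^+-l^-$, where $l^+$ and $l^-$ are the numbers of zeros and of poles of $\omega$ in $\mathbb D$, counted with multiplicity. Then: 1. $\omega$ can be written as $$\omega(z)=\omega_-(z)\,\bigl(z^\kappa\omega_0(z)\bigr)\,\omega_+(z),\qquad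 (*)$$ with rational functions $\omega_-,\omega_0,\omega_+$ such that $\omega_-$ has no poles or zeros outside $\mathbb D$ (i.e. in $|z|\ge 1$), $\omega_+$ has no poles or zeros in $\overline{\mathbb D}$, and $\omega_0$ has all its poles and zeros on $\mathbb T$ (in particular $\omega_0\in\mathrm{Rat}(\mathbb T)$). 2. The factors are unique up to multiplicative constants: if $\omega_-,\omega_0,\omega_+$ and $\omega_-',\omega_0',\omega_+'$ are two such triples, then there are constants $c_-,c_0,c_+\in\mathbb C$ with $c_-c_0c_+=1$ and $\omega_-'=c_-\omega_-$, $\omega_0'=c_0\omega_0$, $\omega_+'=c_+\omega_+$. 3. For every such triple $$T_\omega=T_{\omega_-}\,T_{z^\kappa\omega_0}\,T_{\omega_+},$$ as an equality of unbounded operators, including equality of domains, where a product $ST$ has the domain $\{x\in\mathrm{Dom}(T): Tx\in\mathrm{Dom}(S)\}$. -/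

import Mathlib

open scoped ENNReal

namespace RatToeplitz

open MeasureTheory AddCircle Filter Topology
open scoped Polynomial

/- The unit circle is parametrized by `t ∈ ℝ/ℤ`, `t ↦ exp (2πit)`, with Haar probability measure.
First, the facts on Fourier coefficients which make the Toeplitz-like operator well defined. -/


theorem tendsto_fourierCoeff_zero (F : UnitAddCircle → ℂ) :
    Tendsto (fun n : ℤ => fourierCoeff F n) cofinite (𝓝 0) := by
  have h := Real.tendsto_integral_exp_smul_cocompact
    ((Set.Ioc (0:ℝ) 1).indicator fun x : ℝ => F x)
  have h2 := h.comp Int.tendsto_coe_cofinite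
  refine h2.congr fun n => ?_
  rw [fourierCoeff_eq_intervalIntegral F n 0, intervalIntegral.integral_of_le (by norm_num),
    ← integral_indicator measurableSet_Ioc]
  simp only [Function.comp, one_div, inv_one, one_smul, zero_add]
  congr 1
  ext v
  by_cases hv : v ∈ Set.Ioc (0:ℝ) 1
  · simp only [hv, Set.indicator_of_mem]
    rw [fourier_coe_apply, Circle.smul_def, Real.fourierChar_apply]
    congr 2
    push_cast
    ring
  · simp [hv]

theorem ae_eq_zero_of_fourierCoeff {F : UnitAddCircle → ℂ} (hF : Integrable F haarAddCircle)
    (h : ∀ n, fourierCoeff F n = 0) : F =ᵐ[haarAddCircle] 0 := by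
  have key : ∀ g : C(UnitAddCircle, ℂ), ∫ t, g t * F t ∂haarAddCircle = 0 := by
    let L : C(UnitAddCircle, ℂ) → ℂ := fun g => ∫ t, g t * F t ∂haarAddCircle
    have hint : ∀ g : C(UnitAddCircle, ℂ), Integrable (fun t => g t * F t) haarAddCircle :=
      fun g => hF.bdd_mul g.continuous.aestronglyMeasurable
        (ae_of_all _ fun t => g.norm_coe_le_norm t)
    have hcont : Continuous L := by
      refine continuous_iff_continuousAt.2 fun g0 => ?_
      have : Tendsto (fun g : C(UnitAddCircle, ℂ) => ‖g - g0‖ * ∫ t, ‖F t‖ ∂haarAddCircle)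
          (𝓝 g0) (𝓝 0) := by
        have : Continuous (fun g : C(UnitAddCircle, ℂ) =>
          ‖g - g0‖ * ∫ t, ‖F t‖ ∂haarAddCircle) := by fun_prop
        simpa using this.tendsto g0
      refine tendsto_iff_norm_sub_tendsto_zero.2 (squeeze_zero (fun _ => norm_nonneg _) ?_ this)
      intro g
      simp only [L]
      rw [← integral_sub (hint g) (hint g0), ← integral_const_mul]
      refine norm_integral_le_of_norm_le (hF.norm.const_mul _) (ae_of_all _ fun t => ?_)
      rw [← sub_mul, norm_mul]
      gcongr
      exact (g - g0).norm_coe_le_norm t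
    have hcl : IsClosed {g | L g = 0} := isClosed_eq hcont continuous_const
    intro g
    have hg : g ∈ (Submodule.span ℂ (Set.range <| @fourier (1:ℝ))).topologicalClosure := by
      rw [span_fourier_closure_eq_top]; trivial
    have : ((Submodule.span ℂ (Set.range <| @fourier (1:ℝ)) : Set C(UnitAddCircle, ℂ)))
        ⊆ {g | L g = 0} := by
      intro g hg
      induction hg using Submodule.span_induction with
      | mem x hx =>
        obtain ⟨n, rfl⟩ := hx
        have := h (-n)
        simp only [fourierCoeff, neg_neg, smul_eq_mul] at this
        exact this
      | zero => simp [L]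
      | add x y _ _ hx hy =>
        simp only [Set.mem_ofPred_eq, L, ContinuousMap.add_apply, add_mul] at *
        rw [integral_add (hint x) (hint y), hx, hy, add_zero]
      | smul a x _ hx =>
        simp only [Set.mem_ofPred_eq, L, ContinuousMap.smul_apply, smul_eq_mul, mul_assoc] at *
        rw [integral_const_mul, hx, mul_zero]
    exact closure_minimal this hcl hg
  refine ae_eq_zero_of_forall_setIntegral_isClosed_eq_zero hF fun s hs => ?_
  have hlim := tendsto_integral_of_dominated_convergence (μ := haarAddCircle)
    (F := fun n t => ((thickenedIndicator (Nat.one_div_pos_of_nat (n := n) (α := ℝ)) s t : ℝ) : ℂ) * F t)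
    (f := s.indicator F) (fun t => ‖F t‖) ?_ hF.norm ?_ ?_
  · rw [integral_indicator hs.measurableSet] at hlim
    refine tendsto_nhds_unique hlim ?_
    refine tendsto_const_nhds.congr fun n => ?_
    exact (key ⟨fun t => ((thickenedIndicator
      (Nat.one_div_pos_of_nat (n := n) (α := ℝ)) s t : ℝ) : ℂ), by fun_prop⟩).symm
  · intro n
    refine AEStronglyMeasurable.mul (Continuous.aestronglyMeasurable (by fun_prop)) hF.1
  · intro n
    refine ae_of_all _ fun t => ?_
    rw [norm_mul]
    refine mul_le_of_le_one_left (norm_nonneg _) ?_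
    have := thickenedIndicator_le_one (Nat.one_div_pos_of_nat (n := n) (α := ℝ)) s t
    simpa using this
  · refine ae_of_all _ fun t => ?_
    have h1 := thickenedIndicator_tendsto_indicator_closure
      (δseq := fun n : ℕ => 1 / ((n:ℝ) + 1)) (fun n => Nat.one_div_pos_of_nat)
      tendsto_one_div_add_atTop_nhds_zero_nat s
    have h2 := (tendsto_pi_nhds.1 h1) t
    rw [hs.closure_eq] at h2
    have h3 : Tendsto (fun n : ℕ => ((thickenedIndicator
      (Nat.one_div_pos_of_nat (n := n) (α := ℝ)) s t : ℝ) : ℂ) * F t) atTop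
      (𝓝 ((((s.indicator (fun _ => (1 : NNReal)) t : NNReal) : ℝ) : ℂ) * F t)) := by
      refine Tendsto.mul_const _ ?_
      exact ((Complex.continuous_ofReal.comp NNReal.continuous_coe).tendsto _).comp h2
    convert h3 using 2
    by_cases ht : t ∈ s <;> simp [ht]

/-- The point `exp (2πit)` of the unit circle. -/
noncomputable def circlePt (t : UnitAddCircle) : ℂ := (toCircle t : ℂ)

theorem continuous_circlePt : Continuous circlePt :=
  continuous_subtype_val.comp continuous_toCircle

theorem norm_circlePt (t : UnitAddCircle) : ‖circlePt t‖ = 1 := Circle.norm_coe _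

theorem haar_singleton (t : UnitAddCircle) :
    (haarAddCircle : Measure UnitAddCircle) {t} = 0 := by
  have h := AddCircle.volume_closedBall (T := 1) (x := t) 0
  rw [volume_eq_smul_haarAddCircle] at h
  simpa using h

theorem ae_eval_ne_zero {q : ℂ[X]} (hq : q ≠ 0) :
    ∀ᵐ t ∂(haarAddCircle : Measure UnitAddCircle), q.eval (circlePt t) ≠ 0 := by
  have hcount : {t : UnitAddCircle | ¬ q.eval (circlePt t) ≠ 0}.Countable := by
    refine Set.Finite.countable ?_
    have hf : {z : ℂ | q.IsRoot z}.Finite := Polynomial.finite_setOfPred_isRoot hq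
    refine Set.Finite.subset (hf.preimage (f := circlePt) ?_) fun t ht => by simpa using ht
    intro a _ b _ hab
    exact injective_toCircle one_ne_zero (Subtype.ext hab)
  have : NullSingletonClass (haarAddCircle : Measure UnitAddCircle) := ⟨haar_singleton⟩
  exact hcount.measure_zero _

theorem integrable_circle_mul {F φ : UnitAddCircle → ℂ} (hF : Integrable F haarAddCircle)
    (hφ : Continuous φ) : Integrable (fun t => φ t * F t) haarAddCircle := by
  let g : C(UnitAddCircle, ℂ) := ⟨φ, hφ⟩
  exact hF.bdd_mul g.continuous.aestronglyMeasurable (ae_of_all _ fun t => g.norm_coe_le_norm t)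

theorem memLp_circle_mul {p : ℝ≥0∞} {F φ : UnitAddCircle → ℂ} (hF : MemLp F p haarAddCircle)
    (hφ : Continuous φ) : MemLp (fun t => φ t * F t) p haarAddCircle := by
  let g : C(UnitAddCircle, ℂ) := ⟨φ, hφ⟩
  refine MemLp.of_le_mul (c := ‖g‖) hF (hφ.aestronglyMeasurable.mul hF.1)
    (ae_of_all _ fun t => ?_)
  rw [norm_mul]
  gcongr
  exact g.norm_coe_le_norm t

theorem fourierCoeff_pt_mul (F : UnitAddCircle → ℂ) (n : ℤ) :
    fourierCoeff (fun t => circlePt t * F t) n = fourierCoeff F (n - 1) := by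
  unfold fourierCoeff
  congr 1
  ext t
  rw [show -(n - 1) = -n + 1 by ring, fourier_add, fourier_one]
  simp only [smul_eq_mul, circlePt, mul_assoc]

theorem fourierCoeff_sub' {F G : UnitAddCircle → ℂ} (hF : Integrable F haarAddCircle)
    (hG : Integrable G haarAddCircle) (n : ℤ) :
    fourierCoeff (fun t => F t - G t) n = fourierCoeff F n - fourierCoeff G n := by
  have h := congrFun (fourierCoeff.add hF (hG.const_mul (-1))) n
  rw [Pi.add_apply, fourierCoeff.const_mul] at h
  rw [sub_eq_add_neg, ← neg_one_mul (fourierCoeff G n), ← h]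
  congr 1
  ext t
  simp [sub_eq_add_neg]

theorem fourierCoeff_add' {F G : UnitAddCircle → ℂ} (hF : Integrable F haarAddCircle)
    (hG : Integrable G haarAddCircle) (n : ℤ) :
    fourierCoeff (fun t => F t + G t) n = fourierCoeff F n + fourierCoeff G n :=
  congrFun (fourierCoeff.add hF hG) n

theorem fourierCoeff_const' (c : ℂ) (n : ℤ) :
    fourierCoeff (fun _ : UnitAddCircle => c) n = if n = 0 then c else 0 := by
  have h := congrFun (fourierCoeff_fourier (T := 1) 0) n
  have h2 := fourierCoeff.const_mul (T := 1) (fourier 0) c n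
  rw [h] at h2
  simp only [fourier_zero, mul_one] at h2
  refine h2.trans ?_
  by_cases hn : n = 0 <;> simp [hn]

theorem fourierCoeff_sub_mul {F : UnitAddCircle → ℂ} (hF : Integrable F haarAddCircle)
    (α : ℂ) (n : ℤ) :
    fourierCoeff (fun t => (circlePt t - α) * F t) n
      = fourierCoeff F (n - 1) - α * fourierCoeff F n := by
  simp only [sub_mul]
  rw [fourierCoeff_sub' (integrable_circle_mul hF continuous_circlePt) (hF.const_mul α),
    fourierCoeff_pt_mul, fourierCoeff.const_mul]

/-- Integrable functions on the circle without negative Fourier coefficients. -/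
def IsAnalyticFun (F : UnitAddCircle → ℂ) : Prop :=
  Integrable F haarAddCircle ∧ ∀ n : ℤ, n < 0 → fourierCoeff F n = 0

theorem IsAnalyticFun.add {F G : UnitAddCircle → ℂ} (hF : IsAnalyticFun F)
    (hG : IsAnalyticFun G) : IsAnalyticFun fun t => F t + G t :=
  ⟨hF.1.add hG.1, fun n hn => by
    rw [fourierCoeff_add' hF.1 hG.1, hF.2 n hn, hG.2 n hn, add_zero]⟩

theorem IsAnalyticFun.congr {F G : UnitAddCircle → ℂ} (hF : IsAnalyticFun F)
    (h : F =ᵐ[haarAddCircle] G) : IsAnalyticFun G :=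
  ⟨hF.1.congr h, fun n hn => by rw [← fourierCoeff_congr_ae h, hF.2 n hn]⟩

theorem continuous_polyPt (q : ℂ[X]) : Continuous fun t => q.eval (circlePt t) :=
  q.continuous.comp continuous_circlePt

theorem IsAnalyticFun.poly_mul {F : UnitAddCircle → ℂ} (hF : IsAnalyticFun F) (q : ℂ[X]) :
    IsAnalyticFun fun t => q.eval (circlePt t) * F t := by
  induction q using Polynomial.induction_on' with
  | add a b ha hb => simpa only [Polynomial.eval_add, add_mul] using ha.add hb
  | monomial k c =>
    have hk : ∀ k : ℕ, IsAnalyticFun fun t => circlePt t ^ k * F t := by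
      intro k
      induction k with
      | zero => simpa using hF
      | succ k ih =>
        simp only [pow_succ', mul_assoc]
        exact ⟨integrable_circle_mul ih.1 continuous_circlePt, fun n hn => by
          rw [fourierCoeff_pt_mul]; exact ih.2 _ (by omega)⟩
    simp only [Polynomial.eval_monomial, mul_assoc]
    exact ⟨(hk k).1.const_mul c, fun n hn => by rw [fourierCoeff.const_mul, (hk k).2 n hn, mul_zero]⟩

theorem isAnalyticFun_poly (q : ℂ[X]) : IsAnalyticFun fun t => q.eval (circlePt t) := by
  have h1 : IsAnalyticFun fun _ => (1 : ℂ) :=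
    ⟨integrable_const _, fun n hn => by rw [fourierCoeff_const', if_neg hn.ne]⟩
  simpa using h1.poly_mul q

theorem eq_zero_of_norm_mono {a : ℕ → ℂ} (h : ∀ k, ‖a k‖ ≤ ‖a (k + 1)‖)
    (hlim : Tendsto a atTop (𝓝 0)) (k : ℕ) : a k = 0 := by
  have h1 := (monotone_nat_of_le_succ h).ge_of_tendsto (by simpa using hlim.norm) k
  simpa using h1

/-- Coefficients below `m` vanish, if they satisfy the recurrence with `1 ≤ ‖α‖`. -/
theorem coeff_backward {F : UnitAddCircle → ℂ} {α : ℂ} (hα : 1 ≤ ‖α‖) {m : ℤ}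
    (h : ∀ n < m, fourierCoeff F (n - 1) = α * fourierCoeff F n) (n : ℤ) (hn : n < m) :
    fourierCoeff F n = 0 := by
  have hlim : Tendsto (fun k : ℕ => fourierCoeff F (m - 1 - k)) atTop (𝓝 0) := by
    refine ((tendsto_fourierCoeff_zero F).comp (Function.Injective.tendsto_cofinite
      (f := fun k : ℕ => m - 1 - k) ?_)).mono_left Nat.cofinite_eq_atTop.ge
    intro a b hab; simp only at hab; omega
  have := eq_zero_of_norm_mono (fun k => ?_) hlim (m - 1 - n).toNat
  · rwa [show m - 1 - ((m - 1 - n).toNat : ℤ) = n by omega] at this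
  · rw [show m - 1 - ((k + 1 : ℕ) : ℤ) = m - 1 - k - 1 by push_cast; ring, h _ (by omega), norm_mul]
    exact le_mul_of_one_le_left (norm_nonneg _) hα

/-- Coefficients from `m` on vanish, if they satisfy the recurrence with `‖α‖ ≤ 1`. -/
theorem coeff_forward {F : UnitAddCircle → ℂ} {α : ℂ} (hα : ‖α‖ ≤ 1) {m : ℤ}
    (h : ∀ n > m, fourierCoeff F (n - 1) = α * fourierCoeff F n) (n : ℤ) (hn : m ≤ n) :
    fourierCoeff F n = 0 := by
  have hlim : Tendsto (fun k : ℕ => fourierCoeff F (m + k)) atTop (𝓝 0) := by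
    refine ((tendsto_fourierCoeff_zero F).comp (Function.Injective.tendsto_cofinite
      (f := fun k : ℕ => m + k) ?_)).mono_left Nat.cofinite_eq_atTop.ge
    intro a b hab; simp only at hab; omega
  have := eq_zero_of_norm_mono (fun k => ?_) hlim (n - m).toNat
  · rwa [show m + ((n - m).toNat : ℤ) = n by omega] at this
  · have h1 := h (m + ((k + 1 : ℕ) : ℤ)) (by push_cast; omega)
    rw [show m + ((k + 1 : ℕ) : ℤ) - 1 = m + k by push_cast; ring] at h1
    rw [h1, norm_mul]
    exact mul_le_of_le_one_left (norm_nonneg _) hα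

theorem const_eq_zero_of_sub_mul {F : UnitAddCircle → ℂ} (hF : Integrable F haarAddCircle)
    {α c : ℂ} (hα : ‖α‖ = 1)
    (h : (fun t => (circlePt t - α) * F t) =ᵐ[haarAddCircle] fun _ => c) : c = 0 := by
  have hrec : ∀ n, fourierCoeff F (n - 1) - α * fourierCoeff F n = if n = 0 then c else 0 :=
    fun n => by rw [← fourierCoeff_sub_mul hF, fourierCoeff_congr_ae h, fourierCoeff_const']
  have h1 := coeff_backward (F := F) hα.ge (m := 0)
    (fun n hn => by have := hrec n; rw [if_neg hn.ne] at this; exact sub_eq_zero.1 this)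
  have h2 := coeff_forward (F := F) hα.le (m := 0)
    (fun n hn => by have := hrec n; rw [if_neg hn.ne'] at this; exact sub_eq_zero.1 this)
  have h3 := hrec 0
  rw [h1 _ (by norm_num), h2 0 le_rfl] at h3
  simpa using h3.symm

theorem IsAnalyticFun.of_sub_mul {F : UnitAddCircle → ℂ} (hF : Integrable F haarAddCircle)
    {α : ℂ} (hα : ‖α‖ = 1) (h : IsAnalyticFun fun t => (circlePt t - α) * F t) :
    IsAnalyticFun F :=
  ⟨hF, coeff_backward (α := α) hα.ge fun n hn => by
    have := h.2 n hn
    rw [fourierCoeff_sub_mul hF] at this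
    exact sub_eq_zero.1 this⟩

theorem IsAnalyticFun.of_prod_mul {F : UnitAddCircle → ℂ} (hF : Integrable F haarAddCircle)
    (s : Multiset ℂ) (hs : ∀ α ∈ s, ‖α‖ = 1)
    (h : IsAnalyticFun fun t => (s.map fun α => circlePt t - α).prod * F t) :
    IsAnalyticFun F := by
  induction s using Multiset.induction_on generalizing F with
  | empty => simpa using h
  | cons α s ih =>
    have hα := hs α (Multiset.mem_cons_self α s)
    have hF' := integrable_circle_mul hF (φ := fun t => circlePt t - α)
      (continuous_circlePt.sub continuous_const)
    refine IsAnalyticFun.of_sub_mul hF hα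
      (ih hF' (fun β hβ => hs β (Multiset.mem_cons_of_mem hβ)) ?_)
    refine h.congr (ae_of_all _ fun t => ?_)
    simp only [Multiset.map_cons, Multiset.prod_cons]
    ring

/-- The function `F` splits as a sum of an `L^p` function with no negative Fourier coefficients
and one with no nonnegative Fourier coefficients. -/
def HasRieszSplit (p : ℝ≥0∞) (F : UnitAddCircle → ℂ) : Prop :=
  ∃ H : UnitAddCircle → ℂ, MemLp H p haarAddCircle ∧ (∀ n : ℤ, n < 0 → fourierCoeff H n = 0) ∧
    ∀ n : ℤ, 0 ≤ n → fourierCoeff (fun t => F t - H t) n = 0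

theorem HasRieszSplit.of_sub_mul {p : ℝ≥0∞} (hp : 1 ≤ p) {F : UnitAddCircle → ℂ}
    (hF : MemLp F p haarAddCircle) {α : ℂ} (hα : ‖α‖ ≠ 1)
    (h : HasRieszSplit p fun t => (circlePt t - α) * F t) : HasRieszSplit p F := by
  obtain ⟨H, hH, hneg, hpos⟩ := h
  have hne : ∀ t, circlePt t - α ≠ 0 := fun t ht => hα (by
    rw [← sub_eq_zero.1 ht, norm_circlePt])
  have hψ : Continuous fun t => (circlePt t - α)⁻¹ :=
    (continuous_circlePt.sub continuous_const).inv₀ hne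
  have hFi := hF.integrable hp
  have hHi := hH.integrable hp
  let G : UnitAddCircle → ℂ := fun t => (circlePt t - α)⁻¹
  have hG : MemLp G p haarAddCircle := by
    simpa [G] using memLp_circle_mul (memLp_const (1 : ℂ)) hψ
  have hGi := hG.integrable hp
  have hGrec : ∀ n, fourierCoeff G (n - 1) - α * fourierCoeff G n = if n = 0 then 1 else 0 := by
    intro n
    rw [← fourierCoeff_sub_mul hGi, ← fourierCoeff_const']
    congr 1
    ext t
    exact mul_inv_cancel₀ (hne t)
  -- the candidate projections
  have hcand : ∀ c : ℂ, MemLp (fun t => G t * (H t + c)) p haarAddCircle := fun c =>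
    memLp_circle_mul (hH.add (memLp_const c)) hψ
  have hrecH : ∀ (c : ℂ) (n : ℤ), n < 0 →
      fourierCoeff (fun t => G t * (H t + c)) (n - 1)
        = α * fourierCoeff (fun t => G t * (H t + c)) n := by
    intro c n hn
    rw [← sub_eq_zero, ← fourierCoeff_sub_mul ((hcand c).integrable hp)]
    have : (fun t => (circlePt t - α) * (G t * (H t + c))) = fun t => H t + c := by
      ext t; exact mul_inv_cancel_left₀ (hne t) _
    rw [this, fourierCoeff_add' hHi (integrable_const c), hneg n hn, fourierCoeff_const',
      if_neg hn.ne, add_zero]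
  have hrecK : ∀ (c : ℂ) (n : ℤ), 0 < n →
      fourierCoeff (fun t => F t - G t * (H t + c)) (n - 1)
        = α * fourierCoeff (fun t => F t - G t * (H t + c)) n := by
    intro c n hn
    have hi0 : Integrable (fun t => F t - G t * (H t + c)) haarAddCircle :=
      hFi.sub ((hcand c).integrable hp)
    rw [← sub_eq_zero, ← fourierCoeff_sub_mul hi0]
    have : (fun t => (circlePt t - α) * (F t - G t * (H t + c)))
        = fun t => ((circlePt t - α) * F t - H t) - c := by
      ext t
      rw [mul_sub, mul_inv_cancel_left₀ (hne t)]
      ring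
    have hi : Integrable (fun t => (circlePt t - α) * F t) haarAddCircle :=
      integrable_circle_mul hFi (continuous_circlePt.sub continuous_const)
    have hi2 : Integrable (fun t => (circlePt t - α) * F t - H t) haarAddCircle := hi.sub hHi
    rw [this, fourierCoeff_sub' hi2 (integrable_const c), hpos n hn.le,
      fourierCoeff_const', if_neg hn.ne', sub_zero]
  have hsplit : ∀ (c : ℂ) (n : ℤ), fourierCoeff (fun t => G t * (H t + c)) n
      = fourierCoeff (fun t => G t * H t) n + c * fourierCoeff G n := by
    intro c n
    rw [← fourierCoeff.const_mul, ← fourierCoeff_add' (integrable_circle_mul hHi hψ)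
      (hGi.const_mul c)]
    congr 1
    ext t
    ring
  rcases lt_or_gt_of_ne hα with hlt | hgt
  · have hG0 : fourierCoeff G 0 = 0 := coeff_forward (F := G) hlt.le (m := 0) (fun n hn => by
      have := hGrec n
      rw [if_neg hn.ne'] at this
      exact sub_eq_zero.1 this) 0 le_rfl
    have hG1 : fourierCoeff G (-1) = 1 := by
      have := hGrec 0
      rw [hG0] at this
      simpa using this
    let c := -fourierCoeff (fun t => G t * H t) (-1)
    refine ⟨fun t => G t * (H t + c), hcand c, ?_, fun n hn => ?_⟩
    · have hk : ∀ k : ℕ, fourierCoeff (fun t => G t * (H t + c)) (-1 - k) = 0 := by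
        intro k
        induction k with
        | zero => simp [hsplit, hG1, c]
        | succ k ih =>
          rw [show (-1 : ℤ) - ((k + 1 : ℕ) : ℤ) = -1 - k - 1 by push_cast; ring,
            hrecH c _ (by omega), ih, mul_zero]
      intro n hn
      have := hk (-1 - n).toNat
      rwa [show (-1 : ℤ) - ((-1 - n).toNat : ℤ) = n by omega] at this
    · exact coeff_forward (α := α) hlt.le (m := 0) (fun n hn => hrecK c n hn) n hn
  · have hα0 : α ≠ 0 := fun h0 => by simp [h0] at hgt; linarith
    have hG1 : fourierCoeff G (-1) = 0 := coeff_backward (F := G) hgt.le (m := 0) (fun n hn => by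
      have := hGrec n
      rw [if_neg hn.ne] at this
      exact sub_eq_zero.1 this) (-1) (by norm_num)
    have hG0 : fourierCoeff G 0 ≠ 0 := by
      intro h0
      have := hGrec 0
      rw [h0] at this
      simp [hG1] at this
    let c := (fourierCoeff F 0 - fourierCoeff (fun t => G t * H t) 0) / fourierCoeff G 0
    refine ⟨fun t => G t * (H t + c), hcand c,
      fun n hn => coeff_backward (α := α) hgt.le (m := 0) (fun n hn => hrecH c n hn) n hn, ?_⟩
    have hk : ∀ k : ℕ, fourierCoeff (fun t => F t - G t * (H t + c)) k = 0 := by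
      intro k
      induction k with
      | zero =>
        rw [fourierCoeff_sub' hFi ((hcand c).integrable hp), hsplit]
        simp [c, hG0]
      | succ k ih =>
        have := hrecK c ((k + 1 : ℕ) : ℤ) (by positivity)
        rw [show (((k + 1 : ℕ) : ℤ) - 1) = k by push_cast; ring, ih] at this
        simpa [hα0] using this.symm
    intro n hn
    have := hk n.toNat
    rwa [show (n.toNat : ℤ) = n by omega] at this

theorem HasRieszSplit.of_prod_mul {p : ℝ≥0∞} (hp : 1 ≤ p) {F : UnitAddCircle → ℂ}
    (hF : MemLp F p haarAddCircle) (s : Multiset ℂ) (hs : ∀ α ∈ s, ‖α‖ ≠ 1)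
    (h : HasRieszSplit p fun t => (s.map fun α => circlePt t - α).prod * F t) :
    HasRieszSplit p F := by
  induction s using Multiset.induction_on generalizing F with
  | empty => simpa using h
  | cons α s ih =>
    have hα := hs α (Multiset.mem_cons_self α s)
    have hF' := memLp_circle_mul hF (φ := fun t => circlePt t - α)
      (continuous_circlePt.sub continuous_const)
    refine HasRieszSplit.of_sub_mul hp hF hα
      (ih hF' (fun β hβ => hs β (Multiset.mem_cons_of_mem hβ)) ?_)
    convert h using 2 with t
    simp only [Multiset.map_cons, Multiset.prod_cons]
    ring

theorem continuous_multisetProd (s : Multiset ℂ) :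
    Continuous fun t => (s.map fun α => circlePt t - α).prod := by
  induction s using Multiset.induction_on with
  | empty => simpa using continuous_const
  | cons α s ih =>
    simp only [Multiset.map_cons, Multiset.prod_cons]
    exact (continuous_circlePt.sub continuous_const).mul ih

theorem HasRieszSplit.of_poly_mul {p : ℝ≥0∞} (hp : 1 ≤ p) {F : UnitAddCircle → ℂ}
    (hF : MemLp F p haarAddCircle) {q : ℂ[X]} (hq : q ≠ 0)
    (h : IsAnalyticFun fun t => q.eval (circlePt t) * F t) : HasRieszSplit p F := by
  classical
  have heval : ∀ z, q.eval z = q.leadingCoeff * (q.roots.map fun α => z - α).prod :=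
    fun z => (IsAlgClosed.splits q).eval_eq_prod_roots z
  set s₀ := q.roots.filter fun α => ‖α‖ = 1
  set s₁ := q.roots.filter fun α => ¬ ‖α‖ = 1
  have hs : s₀ + s₁ = q.roots := Multiset.filter_add_not _ _
  have hF1 := memLp_circle_mul hF (continuous_multisetProd s₁)
  have hlc : q.leadingCoeff ≠ 0 := Polynomial.leadingCoeff_ne_zero.2 hq
  have h0 : IsAnalyticFun fun t => (s₀.map fun α => circlePt t - α).prod *
      ((s₁.map fun α => circlePt t - α).prod * F t) := by
    have := h.poly_mul (Polynomial.C q.leadingCoeff⁻¹)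
    refine this.congr (ae_of_all _ fun t => ?_)
    simp only [Polynomial.eval_C]
    rw [heval, ← hs, Multiset.map_add, Multiset.prod_add]
    field_simp
  have h1 := IsAnalyticFun.of_prod_mul (hF1.integrable hp) s₀
    (fun α hα => (Multiset.mem_filter.1 hα).2) h0
  refine HasRieszSplit.of_prod_mul hp hF s₁ (fun α hα => (Multiset.mem_filter.1 hα).2)
    ⟨_, hF1, h1.2, fun n _ => ?_⟩
  simp only [sub_self]
  rw [fourierCoeff_const']
  simp

/-- The space `L^p` of the unit circle (normalized arc length). -/
noncomputable abbrev LpCircle (p : ℝ≥0∞) : Type := Lp ℂ p (haarAddCircle : Measure UnitAddCircle)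

theorem integrable_LpCircle {p : ℝ≥0∞} [hp : Fact (1 ≤ p)] (f : LpCircle p) :
    Integrable f haarAddCircle := (Lp.memLp f).integrable hp.out

theorem fourierCoeff_Lp_add {p : ℝ≥0∞} [Fact (1 ≤ p)] (f g : LpCircle p) (n : ℤ) :
    fourierCoeff (f + g : LpCircle p) n = fourierCoeff f n + fourierCoeff g n := by
  rw [fourierCoeff_congr_ae (Lp.coeFn_add f g)]
  exact congrFun (fourierCoeff.add (integrable_LpCircle f) (integrable_LpCircle g)) n

theorem fourierCoeff_Lp_smul {p : ℝ≥0∞} (c : ℂ) (f : LpCircle p) (n : ℤ) :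
    fourierCoeff (c • f : LpCircle p) n = c * fourierCoeff f n := by
  rw [fourierCoeff_congr_ae (Lp.coeFn_smul c f)]
  exact fourierCoeff.const_smul _ _ _

theorem fourierCoeff_Lp_zero {p : ℝ≥0∞} (n : ℤ) : fourierCoeff (0 : LpCircle p) n = 0 := by
  simpa using fourierCoeff_Lp_smul (p := p) 0 0 n

/-- The functions in `L^p` whose Fourier coefficients vanish on the set of indices `S`. -/
noncomputable def fourierVanishing (p : ℝ≥0∞) [Fact (1 ≤ p)] (S : Set ℤ) :
    Submodule ℂ (LpCircle p) where
  carrier := {f | ∀ n ∈ S, fourierCoeff f n = 0}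
  zero_mem' := fun n _ => fourierCoeff_Lp_zero n
  add_mem' := fun {f g} hf hg n hn => by
    rw [fourierCoeff_Lp_add, hf n hn, hg n hn, add_zero]
  smul_mem' := fun c f hf n hn => by rw [fourierCoeff_Lp_smul, hf n hn, mul_zero]

/-- The Hardy space `H^p`, realized on the circle (through boundary values). -/
noncomputable def hardySpace (p : ℝ≥0∞) [Fact (1 ≤ p)] : Submodule ℂ (LpCircle p) :=
  fourierVanishing p {n | n < 0}

/-- The standard complement `K^p` of `H^p` in `L^p`. -/
noncomputable def hardyCompl (p : ℝ≥0∞) [Fact (1 ≤ p)] : Submodule ℂ (LpCircle p) :=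
  fourierVanishing p {n | 0 ≤ n}

theorem disjoint_hardySpace_hardyCompl (p : ℝ≥0∞) [Fact (1 ≤ p)] :
    Disjoint (hardySpace p) (hardyCompl p) := by
  rw [Submodule.disjoint_def]
  intro f hf hf'
  refine (Lp.eq_zero_iff_ae_eq_zero).2 (ae_eq_zero_of_fourierCoeff (integrable_LpCircle f) ?_)
  intro n
  rcases lt_or_ge n 0 with h | h
  · exact hf n h
  · exact hf' n h

/-- `h = ℙ f`, where `ℙ` is the Riesz projection: the projection of `L^p` onto `H^p`
along `K^p`. -/
def IsRieszProjection {p : ℝ≥0∞} [Fact (1 ≤ p)] (f : LpCircle p) (h : hardySpace p) : Prop :=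
  f - (h : LpCircle p) ∈ hardyCompl p

theorem IsRieszProjection.unique {p : ℝ≥0∞} [Fact (1 ≤ p)] {f : LpCircle p}
    {h₁ h₂ : hardySpace p} (h : IsRieszProjection f h₁) (h' : IsRieszProjection f h₂) :
    h₁ = h₂ := by
  refine Subtype.ext (sub_eq_zero.1 ?_)
  refine (Submodule.disjoint_def.1 (disjoint_hardySpace_hardyCompl p)) _
    ((hardySpace p).sub_mem h₁.2 h₂.2) ?_
  have := (hardyCompl p).sub_mem h' h
  simpa [sub_sub_sub_cancel_left] using this

/-- `z` is a (finite) pole of the rational function `ω`. -/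
def HasPoleAt (ω : RatFunc ℂ) (z : ℂ) : Prop := ω.denom.IsRoot z

/-- `z` is a (finite) zero of the rational function `ω`. -/
def HasZeroAt (ω : RatFunc ℂ) (z : ℂ) : Prop := ω.num.IsRoot z

/-- `Rat(𝕋)`: the rational functions with all poles on the unit circle. -/
def RatT : Set (RatFunc ℂ) := {ω | ∀ z, HasPoleAt ω z → ‖z‖ = 1}

/-- `Rat₀(𝕋)`: the strictly proper rational functions with all poles on the unit circle. -/
def RatT₀ : Set (RatFunc ℂ) := {ω | ω ∈ RatT ∧ ω.num.degree < ω.denom.degree}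

/-- The values of a rational function on the circle; the (finitely many) poles are irrelevant,
as these values are only used almost everywhere. -/
noncomputable def onCircle (ω : RatFunc ℂ) (t : UnitAddCircle) : ℂ :=
  ω.eval (RingHom.id ℂ) (circlePt t)

theorem onCircle_eq (ω : RatFunc ℂ) (t : UnitAddCircle) :
    onCircle ω t = ω.num.eval (circlePt t) / ω.denom.eval (circlePt t) := rfl

theorem onCircle_add (ω₁ ω₂ : RatFunc ℂ) :
    onCircle (ω₁ + ω₂) =ᵐ[haarAddCircle] fun t => onCircle ω₁ t + onCircle ω₂ t := by
  filter_upwards [ae_eval_ne_zero ω₁.denom_ne_zero, ae_eval_ne_zero ω₂.denom_ne_zero] with t h1 h2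
  exact RatFunc.eval_add (f := RingHom.id ℂ) (a := circlePt t) h1 h2

theorem onCircle_C_mul (c : ℂ) (ω : RatFunc ℂ) :
    onCircle (RatFunc.C c * ω) =ᵐ[haarAddCircle] fun t => c * onCircle ω t := by
  filter_upwards [ae_eval_ne_zero ω.denom_ne_zero] with t h1
  have := RatFunc.eval_mul (f := RingHom.id ℂ) (a := circlePt t) (x := RatFunc.C c) (y := ω)
    (by simp) h1
  simpa [onCircle] using this

theorem mem_RatT₀_of_eq {ρ : RatFunc ℂ} {r d : ℂ[X]} (hd : d ≠ 0)
    (hroots : ∀ z, d.IsRoot z → ‖z‖ = 1) (hdeg : r.degree < d.degree)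
    (h : ρ = algebraMap ℂ[X] (RatFunc ℂ) r / algebraMap ℂ[X] (RatFunc ℂ) d) : ρ ∈ RatT₀ := by
  have hdvd : ρ.denom ∣ d := (RatFunc.denom_dvd hd).2 ⟨r, h⟩
  refine ⟨fun z hz => hroots z (hz.dvd hdvd), ?_⟩
  have he : ρ.num * d = r * ρ.denom := (RatFunc.num_mul_eq_mul_denom_iff hd).2 h
  by_cases hr : r = 0
  · have : ρ = 0 := by simp [h, hr]
    simp [this]
  have hdeg' := congrArg Polynomial.degree he
  rw [Polynomial.degree_mul, Polynomial.degree_mul] at hdeg'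
  by_contra hcon
  rw [not_lt] at hcon
  have h1 : r.degree + ρ.denom.degree < d.degree + ρ.denom.degree := by
    rw [Polynomial.degree_eq_natDegree hr, Polynomial.degree_eq_natDegree hd,
      Polynomial.degree_eq_natDegree ρ.denom_ne_zero] at *
    norm_cast at *
    omega
  have h2 : d.degree + ρ.denom.degree ≤ ρ.num.degree + d.degree := by
    rw [add_comm]; gcongr
  exact absurd (h1.trans_le h2) (by rw [hdeg']; exact lt_irrefl _)

theorem RatT₀_add {ρ₁ ρ₂ : RatFunc ℂ} (h₁ : ρ₁ ∈ RatT₀) (h₂ : ρ₂ ∈ RatT₀) : ρ₁ + ρ₂ ∈ RatT₀ := by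
  refine mem_RatT₀_of_eq (r := ρ₁.num * ρ₂.denom + ρ₁.denom * ρ₂.num)
    (d := ρ₁.denom * ρ₂.denom) (mul_ne_zero ρ₁.denom_ne_zero ρ₂.denom_ne_zero) ?_ ?_ ?_
  · intro z hz
    rcases Polynomial.root_mul.1 hz with hz | hz
    · exact h₁.1 z hz
    · exact h₂.1 z hz
  · have hd₁ : ρ₁.denom.degree ≠ ⊥ := by simpa using ρ₁.denom_ne_zero
    have hd₂ : ρ₂.denom.degree ≠ ⊥ := by simpa using ρ₂.denom_ne_zero
    refine (Polynomial.degree_add_le _ _).trans_lt (max_lt ?_ ?_)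
    · rw [Polynomial.degree_mul, Polynomial.degree_mul]
      exact WithBot.add_lt_add_right hd₂ h₁.2
    · rw [Polynomial.degree_mul, Polynomial.degree_mul]
      exact WithBot.add_lt_add_left hd₁ h₂.2
  · have e1 := RatFunc.algebraMap_ne_zero ρ₁.denom_ne_zero
    have e2 := RatFunc.algebraMap_ne_zero ρ₂.denom_ne_zero
    conv_lhs => rw [← RatFunc.num_div_denom ρ₁, ← RatFunc.num_div_denom ρ₂, div_add_div _ _ e1 e2]
    simp

theorem RatT₀_C_mul (c : ℂ) {ρ : RatFunc ℂ} (h : ρ ∈ RatT₀) : RatFunc.C c * ρ ∈ RatT₀ := by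
  refine mem_RatT₀_of_eq (r := Polynomial.C c * ρ.num) (d := ρ.denom) ρ.denom_ne_zero h.1 ?_ ?_
  · refine lt_of_le_of_lt ?_ h.2
    rw [← Polynomial.smul_eq_C_mul]
    exact Polynomial.degree_smul_le c _
  · conv_lhs => rw [← RatFunc.num_div_denom ρ]
    rw [map_mul, RatFunc.algebraMap_C, mul_div_assoc]

theorem zero_mem_RatT₀ : (0 : RatFunc ℂ) ∈ RatT₀ := by
  refine ⟨fun z hz => ?_, by simp⟩
  simp [HasPoleAt] at hz

/-- A strictly proper rational function with all poles on the circle that is integrable on the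
circle is zero. -/
theorem RatT₀_eq_zero {ρ : RatFunc ℂ} (h : ρ ∈ RatT₀) {F : UnitAddCircle → ℂ}
    (hF : Integrable F haarAddCircle) (hρ : F =ᵐ[haarAddCircle] onCircle ρ) : ρ = 0 := by
  by_cases hroot : ∃ α, ρ.denom.IsRoot α
  · exfalso
    obtain ⟨α, hα⟩ := hroot
    obtain ⟨d, hd⟩ := Polynomial.dvd_iff_isRoot.2 hα
    obtain ⟨r, hr⟩ := Polynomial.X_sub_C_dvd_sub_C_eval (a := α) (p := ρ.num)
    have hi : Integrable (fun t => d.eval (circlePt t) * F t - r.eval (circlePt t))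
        haarAddCircle :=
      (integrable_circle_mul hF (continuous_polyPt d)).sub (isAnalyticFun_poly r).1
    have h0 : ρ.num.eval α = 0 := by
      refine const_eq_zero_of_sub_mul hi (h.1 α hα) ?_
      filter_upwards [hρ, ae_eval_ne_zero ρ.denom_ne_zero] with t ht hne
      have e1 : ρ.denom.eval (circlePt t) = (circlePt t - α) * d.eval (circlePt t) := by
        rw [hd]; simp
      have e2 : ρ.num.eval (circlePt t) - ρ.num.eval α
          = (circlePt t - α) * r.eval (circlePt t) := by
        have := congrArg (Polynomial.eval (circlePt t)) hr
        simpa using this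
      rw [onCircle_eq, eq_div_iff hne, e1] at ht
      rw [mul_sub, ← e2, ← ht]
      ring
    obtain ⟨a, b, hab⟩ := ρ.isCoprime_num_denom
    have := congrArg (Polynomial.eval α) hab
    rw [Polynomial.IsRoot.def] at hα
    simp [h0, hα] at this
  · have hdeg : ρ.denom.degree = 0 := by
      by_contra hne
      exact hroot (Complex.exists_root (Polynomial.degree_pos_of_ne_zero_of_nonunit
        ρ.denom_ne_zero (fun hu => hne (Polynomial.degree_eq_zero_of_isUnit hu))))
    have := h.2
    rw [hdeg] at this
    by_contra hne
    exact absurd this (not_lt.2 (Polynomial.zero_le_degree_iff.2 (RatFunc.num_ne_zero hne)))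

/-- The decomposition `ω g = f + ρ` (almost everywhere on the circle) with `f ∈ L^p` and
`ρ ∈ Rat₀(𝕋)`. -/
def IsToeplitzDecomp {p : ℝ≥0∞} [Fact (1 ≤ p)] (ω : RatFunc ℂ) (g : hardySpace p)
    (f : LpCircle p) (ρ : RatFunc ℂ) : Prop :=
  ρ ∈ RatT₀ ∧ ∀ᵐ t ∂(haarAddCircle : Measure UnitAddCircle),
    onCircle ω t * (g : LpCircle p) t = f t + onCircle ρ t

theorem IsToeplitzDecomp.add {p : ℝ≥0∞} [Fact (1 ≤ p)] {ω : RatFunc ℂ} {g₁ g₂ : hardySpace p}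
    {f₁ f₂ : LpCircle p} {ρ₁ ρ₂ : RatFunc ℂ} (h₁ : IsToeplitzDecomp ω g₁ f₁ ρ₁)
    (h₂ : IsToeplitzDecomp ω g₂ f₂ ρ₂) :
    IsToeplitzDecomp ω (g₁ + g₂) (f₁ + f₂) (ρ₁ + ρ₂) := by
  refine ⟨RatT₀_add h₁.1 h₂.1, ?_⟩
  filter_upwards [h₁.2, h₂.2, onCircle_add ρ₁ ρ₂, Lp.coeFn_add f₁ f₂,
    Lp.coeFn_add (g₁ : LpCircle p) g₂] with t e1 e2 e3 e4 e5
  rw [Submodule.coe_add, e3, e4, e5, Pi.add_apply, Pi.add_apply, mul_add, e1, e2]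
  ring

theorem IsToeplitzDecomp.smul {p : ℝ≥0∞} [Fact (1 ≤ p)] {ω : RatFunc ℂ} {g : hardySpace p}
    {f : LpCircle p} {ρ : RatFunc ℂ} (c : ℂ) (h : IsToeplitzDecomp ω g f ρ) :
    IsToeplitzDecomp ω (c • g) (c • f) (RatFunc.C c * ρ) := by
  refine ⟨RatT₀_C_mul c h.1, ?_⟩
  filter_upwards [h.2, onCircle_C_mul c ρ, Lp.coeFn_smul c f,
    Lp.coeFn_smul c (g : LpCircle p)] with t e1 e2 e3 e4
  rw [Submodule.coe_smul, e2, e3, e4, Pi.smul_apply, Pi.smul_apply, smul_eq_mul, smul_eq_mul,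
    mul_left_comm, e1]
  ring

theorem IsToeplitzDecomp.zero {p : ℝ≥0∞} [Fact (1 ≤ p)] (ω : RatFunc ℂ) :
    IsToeplitzDecomp ω (0 : hardySpace p) 0 0 := by
  refine ⟨zero_mem_RatT₀, ?_⟩
  filter_upwards [Lp.coeFn_zero ℂ p (haarAddCircle : Measure UnitAddCircle)] with t e1
  rw [Submodule.coe_zero, e1]
  simp [onCircle]

/-- The `L^p` part of the decomposition is unique. -/
theorem IsToeplitzDecomp.unique {p : ℝ≥0∞} [Fact (1 ≤ p)] {ω : RatFunc ℂ} {g : hardySpace p}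
    {f₁ f₂ : LpCircle p} {ρ₁ ρ₂ : RatFunc ℂ} (h₁ : IsToeplitzDecomp ω g f₁ ρ₁)
    (h₂ : IsToeplitzDecomp ω g f₂ ρ₂) : f₁ = f₂ := by
  have h := h₂.add (h₁.smul (-1))
  have hz : RatFunc.C (-1 : ℂ) * ρ₁ + ρ₂ = 0 := by
    refine RatT₀_eq_zero (F := ⇑(f₁ - f₂)) (RatT₀_add (RatT₀_C_mul _ h₁.1) h₂.1)
      (integrable_LpCircle _) ?_
    filter_upwards [h₁.2, h₂.2, Lp.coeFn_sub f₁ f₂, onCircle_add (RatFunc.C (-1 : ℂ) * ρ₁) ρ₂,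
      onCircle_C_mul (-1) ρ₁] with t e1 e2 e3 e4 e5
    rw [e3, e4, e5, Pi.sub_apply]
    rw [e1] at e2
    linear_combination e2
  have hρ : ρ₂ = ρ₁ := by
    have : -ρ₁ + ρ₂ = 0 := by simpa using hz
    exact (neg_add_eq_zero.1 this).symm
  subst hρ
  refine Lp.ext ?_
  filter_upwards [h₁.2, h₂.2] with t e1 e2
  rw [e1] at e2
  exact add_right_cancel e2

/-- The `L^p` part of the decomposition has a Riesz projection. (For `1 < p < ∞` every function
in `L^p` has one, by the theorem of M. Riesz; here there is a direct argument.) -/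
theorem IsToeplitzDecomp.exists_isRieszProjection {p : ℝ≥0∞} [hp : Fact (1 ≤ p)] {ω : RatFunc ℂ}
    {g : hardySpace p} {f : LpCircle p} {ρ : RatFunc ℂ} (h : IsToeplitzDecomp ω g f ρ) :
    ∃ h : hardySpace p, IsRieszProjection f h := by
  have hg : IsAnalyticFun (g : LpCircle p) := ⟨integrable_LpCircle _, g.2⟩
  have hQ : IsAnalyticFun fun t => (ω.denom * ρ.denom).eval (circlePt t) * f t := by
    refine ((hg.poly_mul (ω.num * ρ.denom)).add
      (isAnalyticFun_poly (-(ω.denom * ρ.num)))).congr ?_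
    filter_upwards [h.2, ae_eval_ne_zero ω.denom_ne_zero, ae_eval_ne_zero ρ.denom_ne_zero]
      with t e1 e2 e3
    rw [onCircle_eq, onCircle_eq] at e1
    field_simp at e1
    simp only [Polynomial.eval_mul, Polynomial.eval_neg]
    linear_combination e1
  obtain ⟨H, hH, hneg, hpos⟩ := HasRieszSplit.of_poly_mul hp.out (Lp.memLp f)
    (mul_ne_zero ω.denom_ne_zero ρ.denom_ne_zero) hQ
  have hmem : hH.toLp H ∈ hardySpace p := fun n hn => by
    rw [fourierCoeff_congr_ae hH.coeFn_toLp]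
    exact hneg n hn
  refine ⟨⟨hH.toLp H, hmem⟩, fun n hn => ?_⟩
  refine (congrFun (fourierCoeff_congr_ae ?_) n).trans (hpos n hn)
  filter_upwards [Lp.coeFn_sub f (hH.toLp H), hH.coeFn_toLp] with t e1 e2
  rw [e1, Pi.sub_apply, e2]

/-- `T_ω g = h`, i.e. `ω g = f + ρ` with `f ∈ L^p`, `ρ ∈ Rat₀(𝕋)`, and `h = ℙ f`. -/
def IsToeplitzValue {p : ℝ≥0∞} [Fact (1 ≤ p)] (ω : RatFunc ℂ) (g h : hardySpace p) : Prop :=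
  ∃ (f : LpCircle p) (ρ : RatFunc ℂ), IsToeplitzDecomp ω g f ρ ∧ IsRieszProjection f h

theorem IsToeplitzValue.unique {p : ℝ≥0∞} [Fact (1 ≤ p)] {ω : RatFunc ℂ} {g h₁ h₂ : hardySpace p}
    (e₁ : IsToeplitzValue ω g h₁) (e₂ : IsToeplitzValue ω g h₂) : h₁ = h₂ := by
  obtain ⟨f₁, ρ₁, d₁, r₁⟩ := e₁
  obtain ⟨f₂, ρ₂, d₂, r₂⟩ := e₂
  obtain rfl := d₁.unique d₂
  exact r₁.unique r₂

theorem IsToeplitzValue.add {p : ℝ≥0∞} [Fact (1 ≤ p)] {ω : RatFunc ℂ}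
    {g₁ g₂ h₁ h₂ : hardySpace p} (e₁ : IsToeplitzValue ω g₁ h₁) (e₂ : IsToeplitzValue ω g₂ h₂) :
    IsToeplitzValue ω (g₁ + g₂) (h₁ + h₂) := by
  obtain ⟨f₁, ρ₁, d₁, r₁⟩ := e₁
  obtain ⟨f₂, ρ₂, d₂, r₂⟩ := e₂
  refine ⟨f₁ + f₂, ρ₁ + ρ₂, d₁.add d₂, ?_⟩
  have := (hardyCompl p).add_mem r₁ r₂
  rwa [sub_add_sub_comm] at this

theorem IsToeplitzValue.smul {p : ℝ≥0∞} [Fact (1 ≤ p)] {ω : RatFunc ℂ} {g h : hardySpace p}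
    (c : ℂ) (e : IsToeplitzValue ω g h) : IsToeplitzValue ω (c • g) (c • h) := by
  obtain ⟨f, ρ, d, r⟩ := e
  refine ⟨c • f, RatFunc.C c * ρ, d.smul c, ?_⟩
  have := (hardyCompl p).smul_mem c r
  rwa [smul_sub] at this

/-- The domain of `T_ω`: all `g ∈ H^p` with `ω g = f + ρ`, `f ∈ L^p`, `ρ ∈ Rat₀(𝕋)`. -/
def toeplitzDomain (p : ℝ≥0∞) [Fact (1 ≤ p)] (ω : RatFunc ℂ) : Submodule ℂ (hardySpace p) where
  carrier := {g | ∃ (f : LpCircle p) (ρ : RatFunc ℂ), IsToeplitzDecomp ω g f ρ}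
  zero_mem' := ⟨0, 0, IsToeplitzDecomp.zero ω⟩
  add_mem' := by
    rintro _ _ ⟨f₁, ρ₁, h₁⟩ ⟨f₂, ρ₂, h₂⟩
    exact ⟨_, _, h₁.add h₂⟩
  smul_mem' := by
    rintro c _ ⟨f, ρ, h⟩
    exact ⟨_, _, h.smul c⟩

theorem exists_isToeplitzValue {p : ℝ≥0∞} [Fact (1 ≤ p)] {ω : RatFunc ℂ} {g : hardySpace p}
    (hg : g ∈ toeplitzDomain p ω) : ∃ h : hardySpace p, IsToeplitzValue ω g h := by
  obtain ⟨f, ρ, d⟩ := hg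
  obtain ⟨h, hh⟩ := d.exists_isRieszProjection
  exact ⟨h, f, ρ, d, hh⟩

/-- The (unbounded) Toeplitz-like operator `T_ω` on `H^p`. -/
noncomputable def toeplitz (p : ℝ≥0∞) [Fact (1 ≤ p)] (ω : RatFunc ℂ) :
    hardySpace p →ₗ.[ℂ] hardySpace p where
  domain := toeplitzDomain p ω
  toFun :=
    { toFun := fun g => Classical.choose (exists_isToeplitzValue g.2)
      map_add' := fun g₁ g₂ =>
        (Classical.choose_spec (exists_isToeplitzValue (g₁ + g₂).2)).unique
          ((Classical.choose_spec (exists_isToeplitzValue g₁.2)).add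
            (Classical.choose_spec (exists_isToeplitzValue g₂.2)))
      map_smul' := fun c g =>
        (Classical.choose_spec (exists_isToeplitzValue (c • g).2)).unique
          ((Classical.choose_spec (exists_isToeplitzValue g.2)).smul c) }

/-- The value of `T_ω` can be computed from any decomposition. -/
theorem toeplitz_apply_eq_iff {p : ℝ≥0∞} [Fact (1 ≤ p)] {ω : RatFunc ℂ}
    (g : (toeplitz p ω).domain) (h : hardySpace p) :
    toeplitz p ω g = h ↔ IsToeplitzValue ω (g : hardySpace p) h :=
  ⟨fun e => e ▸ Classical.choose_spec (exists_isToeplitzValue g.2),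
    fun e => (Classical.choose_spec (exists_isToeplitzValue g.2)).unique e⟩

/-- The product `S T` of two partially defined operators, on its natural domain
`{x ∈ Dom T | T x ∈ Dom S}`. -/
def unboundedProd {E : Type*} [AddCommGroup E] [Module ℂ E] (S T : E →ₗ.[ℂ] E) :
    E →ₗ.[ℂ] E where
  domain :=
    { carrier := {x | ∃ hx : x ∈ T.domain, T ⟨x, hx⟩ ∈ S.domain}
      zero_mem' := ⟨T.domain.zero_mem, by
        have : T ⟨0, T.domain.zero_mem⟩ = 0 := T.map_zero
        rw [this]
        exact S.domain.zero_mem⟩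
      add_mem' := by
        rintro x y ⟨hx, hx'⟩ ⟨hy, hy'⟩
        refine ⟨T.domain.add_mem hx hy, ?_⟩
        have : T ⟨x + y, T.domain.add_mem hx hy⟩ = T ⟨x, hx⟩ + T ⟨y, hy⟩ :=
          T.map_add ⟨x, hx⟩ ⟨y, hy⟩
        rw [this]
        exact S.domain.add_mem hx' hy'
      smul_mem' := by
        rintro c x ⟨hx, hx'⟩
        refine ⟨T.domain.smul_mem c hx, ?_⟩
        have : T ⟨c • x, T.domain.smul_mem c hx⟩ = c • T ⟨x, hx⟩ := T.map_smul c ⟨x, hx⟩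
        rw [this]
        exact S.domain.smul_mem c hx' }
  toFun :=
    { toFun := fun x => S ⟨T ⟨x, x.2.fst⟩, x.2.snd⟩
      map_add' := fun x y => by
        rw [← S.map_add]
        congr 1
        exact Subtype.ext (T.map_add ⟨x, x.2.fst⟩ ⟨y, y.2.fst⟩)
      map_smul' := fun c x => by
        rw [RingHom.id_apply, ← S.map_smul]
        congr 1
        exact Subtype.ext (T.map_smul c ⟨x, x.2.fst⟩) }

/-- `κ`: the number of zeros minus the number of poles in the open unit disc, counted with
multiplicity. -/
noncomputable def discIndex (ω : RatFunc ℂ) : ℤ :=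
  (((ω.num.roots.filter fun z => ‖z‖ < 1).card : ℕ) : ℤ)
    - (((ω.denom.roots.filter fun z => ‖z‖ < 1).card : ℕ) : ℤ)

/-- `ω = ω₋ (z^κ ω₀) ω₊` with `κ` the disc index of `ω`, where `ω₋` has no poles or zeros outside
the open disc, `ω₀` has all its poles and zeros on the circle, and `ω₊` has no poles or zeros in
the closed disc. -/
structure IsWienerHopfFactorization (ω ωm ω₀ ωp : RatFunc ℂ) : Prop where
  eq_mul : ω = ωm * (RatFunc.X ^ discIndex ω * ω₀) * ωp
  minus : ∀ z : ℂ, 1 ≤ ‖z‖ → ¬ HasPoleAt ωm z ∧ ¬ HasZeroAt ωm z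
  middle_mem : ω₀ ∈ RatT
  middle_zeros : ∀ z : ℂ, HasZeroAt ω₀ z → ‖z‖ = 1
  plus : ∀ z : ℂ, ‖z‖ ≤ 1 → ¬ HasPoleAt ωp z ∧ ¬ HasZeroAt ωp z

end RatToeplitz

open RatToeplitz

/-! The factorization comes from sorting the zeros and poles of `ω` into those inside, on and
outside the circle. With `N1`, `D1` the monic polynomials carrying the zeros and poles in the disc,
`N1 / D1` equals `z^κ` times a quotient whose numerator and denominator have equal degree; that
quotient is `ω₋`. Uniqueness is a comparison of orders: at each point at most one of the three
factors can have nonzero order, and the power `z^κ` is common to both triples, so the orders of each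
factor are determined by `ω`. A nonzero rational function is determined by its orders up to a
constant.

The conditions on `ω₋` concern finite points only. That it is also finite and nonzero at infinity,
which the operator identity needs, holds for the constructed triple and passes to every triple by
uniqueness.

For the operators, `T_ω` is treated as the relation `IsToeplitzValue` between `g` and `T_ω g`, and
its behaviour is studied when the symbol is multiplied from either side. On the right, `ω₊` has its
poles outside the closed disc, so it maps `H^p` into itself, `T_{ω₊} g = ω₊ g` for all `g`, and the
decompositions of `(ψ ω₊) g` are exactly those of `ψ (ω₊ g)` (`isToeplitzValue_mul_plus_iff`).

On the left, multiplication by `ω₋ = a / b` preserves `K^p`, because `b` has its roots in the disc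
and `deg a ≤ deg b`; and it maps `Rat₀(𝕋)` into `K^p + Rat₀(𝕋)` by partial fractions. Hence `ψ g = f
+ ρ` gives `ω₋ ψ g = (ω₋ f + η) + ρ'` with `η ∈ K^p`, and modulo `K^p` the function `ω₋ f + η`
agrees with `ω₋ ℙ f`. Since `1 / ω₋` is of the same kind, every decomposition for `ω₋ ψ` arises in
this way, which gives equality of domains (`isToeplitzValue_minus_mul_iff`).

Both invariance statements rest on one principle: dividing by `z - α` turns vanishing of Fourier
coefficients into a recurrence along which their moduli do not decrease towards infinity, while by
Riemann–Lebesgue they tend to zero. -/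

namespace RatToeplitz

open MeasureTheory AddCircle Filter Topology
open scoped Polynomial

/-! ### Orders of rational functions at points -/

/-- The order of the rational function `ω` at `z`. -/
noncomputable def ratOrd (z : ℂ) (ω : RatFunc ℂ) : ℤ :=
  (ω.num.rootMultiplicity z : ℤ) - ω.denom.rootMultiplicity z

/-- Cancellation prevents `num` and `denom` from being multiplicative, but the cross-multiplied
identity between them is a polynomial identity, and root multiplicities add in it. -/
theorem ratOrd_mul (z : ℂ) {x y : RatFunc ℂ} (hx : x ≠ 0) (hy : y ≠ 0) :
    ratOrd z (x * y) = ratOrd z x + ratOrd z y := by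
  have h := congrArg (Polynomial.rootMultiplicity z) (RatFunc.num_denom_mul x y)
  have hxn := RatFunc.num_ne_zero hx
  have hyn := RatFunc.num_ne_zero hy
  have hxyn := RatFunc.num_ne_zero (mul_ne_zero hx hy)
  have hxd := x.denom_ne_zero
  have hyd := y.denom_ne_zero
  have hxyd := (x * y).denom_ne_zero
  rw [Polynomial.rootMultiplicity_mul (by positivity), Polynomial.rootMultiplicity_mul (by positivity),
    Polynomial.rootMultiplicity_mul (by positivity), Polynomial.rootMultiplicity_mul (by positivity)] at h
  unfold ratOrd
  omega

theorem ratOrd_eq_zero {z : ℂ} {x : RatFunc ℂ} (hp : ¬ HasPoleAt x z) (hz : ¬ HasZeroAt x z) :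
    ratOrd z x = 0 := by
  rw [ratOrd, Polynomial.rootMultiplicity_eq_zero hp, Polynomial.rootMultiplicity_eq_zero hz,
    sub_self]

theorem exists_C_mul_of_rootMultiplicity {a b : ℂ[X]} (ha : a ≠ 0) (hb : b ≠ 0)
    (h : ∀ z, a.rootMultiplicity z = b.rootMultiplicity z) :
    ∃ c : ℂ, c ≠ 0 ∧ b = Polynomial.C c * a := by
  classical
  have hr : a.roots = b.roots := by
    ext z
    rw [Polynomial.count_roots, Polynomial.count_roots, h]
  have ea := (IsAlgClosed.splits a).eq_prod_roots
  have eb := (IsAlgClosed.splits b).eq_prod_roots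
  have hla : a.leadingCoeff ≠ 0 := Polynomial.leadingCoeff_ne_zero.2 ha
  have hlb : b.leadingCoeff ≠ 0 := Polynomial.leadingCoeff_ne_zero.2 hb
  refine ⟨b.leadingCoeff / a.leadingCoeff, div_ne_zero hlb hla, ?_⟩
  rw [hr] at ea
  refine eb.trans ?_
  refine Eq.trans ?_ (congrArg (Polynomial.C (b.leadingCoeff / a.leadingCoeff) * ·) ea).symm
  rw [← mul_assoc, ← Polynomial.C_mul, div_mul_cancel₀ _ hla]

/-- Equal orders mean that the cross products `x.num * y.denom` and `y.num * x.denom` have the same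
roots with multiplicity, so the polynomial case applies to them. -/
theorem exists_C_mul_of_ratOrd {x y : RatFunc ℂ} (hx : x ≠ 0) (hy : y ≠ 0)
    (h : ∀ z, ratOrd z x = ratOrd z y) : ∃ c : ℂ, c ≠ 0 ∧ y = RatFunc.C c * x := by
  have hxn := RatFunc.num_ne_zero hx
  have hyn := RatFunc.num_ne_zero hy
  have hxd := x.denom_ne_zero
  have hyd := y.denom_ne_zero
  obtain ⟨c, hc, e⟩ := exists_C_mul_of_rootMultiplicity (a := x.num * y.denom)
    (b := y.num * x.denom) (by positivity) (by positivity) (fun z => by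
      have := h z
      unfold ratOrd at this
      rw [Polynomial.rootMultiplicity_mul (by positivity),
        Polynomial.rootMultiplicity_mul (by positivity)]
      omega)
  refine ⟨c, hc, ?_⟩
  have e' := congrArg (algebraMap ℂ[X] (RatFunc ℂ)) e
  simp only [map_mul, RatFunc.algebraMap_C] at e'
  have hxd' := RatFunc.algebraMap_ne_zero hxd
  have hyd' := RatFunc.algebraMap_ne_zero hyd
  rw [← RatFunc.num_div_denom x, ← RatFunc.num_div_denom y, ← mul_div_assoc,
    div_eq_div_iff hyd' hxd', e', mul_assoc]

/-! ### Existence of the factorization -/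

theorem HasPoleAt.of_div {a b : ℂ[X]} (hb : b ≠ 0) {z : ℂ}
    (h : HasPoleAt (algebraMap ℂ[X] (RatFunc ℂ) a / algebraMap ℂ[X] (RatFunc ℂ) b) z) :
    b.IsRoot z :=
  h.dvd ((RatFunc.denom_dvd hb).2 ⟨a, rfl⟩)

theorem HasZeroAt.of_div {a b : ℂ[X]} (hb : b ≠ 0) {z : ℂ}
    (h : HasZeroAt (algebraMap ℂ[X] (RatFunc ℂ) a / algebraMap ℂ[X] (RatFunc ℂ) b) z) :
    a.IsRoot z :=
  Polynomial.IsRoot.dvd h (RatFunc.num_div_dvd a hb)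

/-- The monic polynomial whose roots are the elements of `s` with `P`. -/
noncomputable def rootsPart (P : ℂ → Prop) (s : Multiset ℂ) : ℂ[X] := by
  classical
  exact ((s.filter P).map fun α => Polynomial.X - Polynomial.C α).prod

theorem rootsPart_monic (P : ℂ → Prop) (s : Multiset ℂ) : (rootsPart P s).Monic :=
  Polynomial.monic_multiset_prod_of_monic _ _ fun α _ => Polynomial.monic_X_sub_C α

theorem rootsPart_isRoot {P : ℂ → Prop} {s : Multiset ℂ} {z : ℂ} (h : (rootsPart P s).IsRoot z) :
    P z := by
  classical
  rw [← Polynomial.mem_roots (rootsPart_monic P s).ne_zero, rootsPart,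
    Polynomial.roots_multiset_prod_X_sub_C] at h
  exact (Multiset.mem_filter.1 h).2

/-- The decidability instance is arbitrary, so that the count can be matched with the one in
`discIndex`. -/
theorem natDegree_rootsPart (P : ℂ → Prop) [DecidablePred P] (s : Multiset ℂ) :
    (rootsPart P s).natDegree = (s.filter P).card := by
  rw [rootsPart, Polynomial.natDegree_multiset_prod_X_sub_C_eq_card]
  congr!

theorem eq_C_mul_rootsPart (q : ℂ[X]) :
    q = Polynomial.C q.leadingCoeff * (rootsPart (fun z => ‖z‖ < 1) q.roots *
      rootsPart (fun z => ‖z‖ = 1) q.roots * rootsPart (fun z => 1 < ‖z‖) q.roots) := by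
  classical
  conv_lhs => rw [(IsAlgClosed.splits q).eq_prod_roots]
  congr 1
  unfold rootsPart
  rw [← Multiset.prod_add, ← Multiset.prod_add, ← Multiset.map_add, ← Multiset.map_add]
  congr 2
  ext z
  simp only [Multiset.count_add, Multiset.count_filter]
  rcases lt_trichotomy ‖z‖ 1 with h | h | h
  · simp [h, h.ne, h.not_gt]
  · simp [h]
  · simp [h, h.ne', h.not_gt]

/-- `x = a / b` with polynomials `a`, `b` of the same degree and with all roots in the open
disc. -/
structure IsMinusQuotient (x : RatFunc ℂ) (a b : ℂ[X]) : Prop where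
  eq_div : x = algebraMap ℂ[X] (RatFunc ℂ) a / algebraMap ℂ[X] (RatFunc ℂ) b
  num_ne_zero : a ≠ 0
  denom_ne_zero : b ≠ 0
  natDegree_eq : a.natDegree = b.natDegree
  num_roots : ∀ z, a.IsRoot z → ‖z‖ < 1
  denom_roots : ∀ z, b.IsRoot z → ‖z‖ < 1

theorem IsMinusQuotient.inv {x : RatFunc ℂ} {a b : ℂ[X]} (h : IsMinusQuotient x a b) :
    IsMinusQuotient x⁻¹ b a :=
  ⟨by rw [h.eq_div, inv_div], h.denom_ne_zero, h.num_ne_zero, h.natDegree_eq.symm, h.denom_roots,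
    h.num_roots⟩

theorem IsMinusQuotient.C_mul {x : RatFunc ℂ} {a b : ℂ[X]} (h : IsMinusQuotient x a b) {c : ℂ}
    (hc : c ≠ 0) : IsMinusQuotient (RatFunc.C c * x) (Polynomial.C c * a) b := by
  refine ⟨by rw [h.eq_div, map_mul, RatFunc.algebraMap_C, mul_div_assoc],
    mul_ne_zero (Polynomial.C_ne_zero.2 hc) h.num_ne_zero, h.denom_ne_zero, ?_, fun z hz => ?_,
    h.denom_roots⟩
  · rw [Polynomial.natDegree_C_mul hc, h.natDegree_eq]
  · refine h.num_roots z ?_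
    simpa [hc] using hz

theorem exists_isWienerHopfFactorization {ω : RatFunc ℂ} (hω : ω ≠ 0) :
    ∃ ωm ω₀ ωp : RatFunc ℂ, IsWienerHopfFactorization ω ωm ω₀ ωp ∧
      ∃ a b : ℂ[X], IsMinusQuotient ωm a b := by
  classical
  have hlc : ω.num.leadingCoeff ≠ 0 := Polynomial.leadingCoeff_ne_zero.2 (RatFunc.num_ne_zero hω)
  have hN := eq_C_mul_rootsPart ω.num
  have hD := eq_C_mul_rootsPart ω.denom
  rw [ω.monic_denom.leadingCoeff, Polynomial.C_1, one_mul] at hD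
  have hκ : discIndex ω = ((rootsPart (fun z => ‖z‖ < 1) ω.num.roots).natDegree : ℤ) -
      (rootsPart (fun z => ‖z‖ < 1) ω.denom.roots).natDegree := by
    rw [natDegree_rootsPart, natDegree_rootsPart]
    unfold discIndex
    congr!
  generalize hN1 : rootsPart (fun z => ‖z‖ < 1) ω.num.roots = N1 at *
  generalize hN0 : rootsPart (fun z => ‖z‖ = 1) ω.num.roots = N0 at *
  generalize hN2 : rootsPart (fun z => 1 < ‖z‖) ω.num.roots = N2 at *
  generalize hD1 : rootsPart (fun z => ‖z‖ < 1) ω.denom.roots = D1 at *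
  generalize hD0 : rootsPart (fun z => ‖z‖ = 1) ω.denom.roots = D0 at *
  generalize hD2 : rootsPart (fun z => 1 < ‖z‖) ω.denom.roots = D2 at *
  have mN1 : N1.Monic := hN1 ▸ rootsPart_monic _ _
  have mN0 : N0.Monic := hN0 ▸ rootsPart_monic _ _
  have mN2 : N2.Monic := hN2 ▸ rootsPart_monic _ _
  have mD1 : D1.Monic := hD1 ▸ rootsPart_monic _ _
  have mD0 : D0.Monic := hD0 ▸ rootsPart_monic _ _
  have mD2 : D2.Monic := hD2 ▸ rootsPart_monic _ _
  have rN1 : ∀ z, N1.IsRoot z → ‖z‖ < 1 := fun z h => rootsPart_isRoot (hN1 ▸ h)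
  have rN0 : ∀ z, N0.IsRoot z → ‖z‖ = 1 := fun z h =>
    rootsPart_isRoot (P := fun z => ‖z‖ = 1) (hN0 ▸ h)
  have rN2 : ∀ z, N2.IsRoot z → 1 < ‖z‖ := fun z h => rootsPart_isRoot (hN2 ▸ h)
  have rD1 : ∀ z, D1.IsRoot z → ‖z‖ < 1 := fun z h => rootsPart_isRoot (hD1 ▸ h)
  have rD0 : ∀ z, D0.IsRoot z → ‖z‖ = 1 := fun z h =>
    rootsPart_isRoot (P := fun z => ‖z‖ = 1) (hD0 ▸ h)
  have rD2 : ∀ z, D2.IsRoot z → 1 < ‖z‖ := fun z h => rootsPart_isRoot (hD2 ▸ h)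
  have hX : ∀ (q : ℂ[X]) (n : ℕ), (∀ z, q.IsRoot z → ‖z‖ < 1) →
      ∀ z, (q * Polynomial.X ^ n).IsRoot z → ‖z‖ < 1 := by
    intro q n hq z hz
    rcases Polynomial.root_mul.1 hz with h | h
    · exact hq z h
    · have : z = 0 := by
        simp only [Polynomial.IsRoot.def, Polynomial.eval_pow, Polynomial.eval_X] at h
        exact eq_zero_of_pow_eq_zero h
      simp [this]
  have hnum : N1 * Polynomial.X ^ D1.natDegree ≠ 0 :=
    (mN1.mul (Polynomial.monic_X_pow _)).ne_zero
  have hden : D1 * Polynomial.X ^ N1.natDegree ≠ 0 :=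
    (mD1.mul (Polynomial.monic_X_pow _)).ne_zero
  -- The powers of `X` give numerator and denominator of `ω₋` the common degree `deg N1 + deg D1`;
  -- their quotient is `X ^ (-κ)`, compensating the middle factor. They add roots only at the
  -- origin. The leading coefficient of `ω.num` is put into `ω₊`.
  refine ⟨algebraMap ℂ[X] (RatFunc ℂ) (N1 * Polynomial.X ^ D1.natDegree) /
      algebraMap ℂ[X] (RatFunc ℂ) (D1 * Polynomial.X ^ N1.natDegree),
    algebraMap ℂ[X] (RatFunc ℂ) N0 / algebraMap ℂ[X] (RatFunc ℂ) D0,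
    algebraMap ℂ[X] (RatFunc ℂ) (Polynomial.C ω.num.leadingCoeff * N2) /
      algebraMap ℂ[X] (RatFunc ℂ) D2, ⟨?_, fun z hz => ⟨fun h => ?_, fun h => ?_⟩,
        fun z h => rD0 z (h.of_div mD0.ne_zero), fun z h => rN0 z (h.of_div mD0.ne_zero),
        fun z hz => ⟨fun h => ?_, fun h => ?_⟩⟩,
    _, _, rfl, hnum, hden, ?_, hX _ _ rN1, hX _ _ rD1⟩
  · have e1 := RatFunc.algebraMap_ne_zero mD1.ne_zero
    have e2 := RatFunc.algebraMap_ne_zero mD0.ne_zero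
    have e3 := RatFunc.algebraMap_ne_zero mD2.ne_zero
    have hX0 : (RatFunc.X : RatFunc ℂ) ≠ 0 := RatFunc.X_ne_zero
    conv_lhs => rw [← RatFunc.num_div_denom ω, hN, hD]
    rw [hκ, zpow_sub₀ hX0, zpow_natCast, zpow_natCast]
    simp only [map_mul, map_pow, RatFunc.algebraMap_X]
    field_simp
  · exact absurd (hX _ _ rD1 z (h.of_div hden)) hz.not_gt
  · exact absurd (hX _ _ rN1 z (h.of_div hden)) hz.not_gt
  · exact absurd (rD2 z (h.of_div mD2.ne_zero)) hz.not_gt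
  · refine absurd (rN2 z ?_) hz.not_gt
    simpa [hlc] using h.of_div mD2.ne_zero
  · rw [mN1.natDegree_mul (Polynomial.monic_X_pow _), mD1.natDegree_mul (Polynomial.monic_X_pow _),
      Polynomial.natDegree_X_pow, Polynomial.natDegree_X_pow, add_comm]

/-! ### Uniqueness of the factors -/

theorem IsWienerHopfFactorization.factors_ne_zero {ω ωm ω₀ ωp : RatFunc ℂ} (hω : ω ≠ 0)
    (h : IsWienerHopfFactorization ω ωm ω₀ ωp) : ωm ≠ 0 ∧ ω₀ ≠ 0 ∧ ωp ≠ 0 := by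
  have := h.eq_mul
  refine ⟨?_, ?_, ?_⟩ <;> rintro rfl <;> simp [hω] at this

theorem IsWienerHopfFactorization.ratOrd_eq {ω ωm ω₀ ωp : RatFunc ℂ} (hω : ω ≠ 0)
    (h : IsWienerHopfFactorization ω ωm ω₀ ωp) (z : ℂ) :
    ratOrd z ω = ratOrd z ωm + (ratOrd z (RatFunc.X ^ discIndex ω) + ratOrd z ω₀)
      + ratOrd z ωp := by
  obtain ⟨h1, h2, h3⟩ := h.factors_ne_zero hω
  have hX : (RatFunc.X : RatFunc ℂ) ^ discIndex ω ≠ 0 := zpow_ne_zero _ RatFunc.X_ne_zero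
  conv_lhs => rw [h.eq_mul, ratOrd_mul z (mul_ne_zero h1 (mul_ne_zero hX h2)) h3,
    ratOrd_mul z h1 (mul_ne_zero hX h2), ratOrd_mul z hX h2]

theorem IsWienerHopfFactorization.ratOrd_middle {ω ωm ω₀ ωp : RatFunc ℂ}
    (h : IsWienerHopfFactorization ω ωm ω₀ ωp) {z : ℂ} (hz : ‖z‖ ≠ 1) : ratOrd z ω₀ = 0 :=
  ratOrd_eq_zero (fun hp => hz (h.middle_mem z hp)) (fun h0 => hz (h.middle_zeros z h0))

/-- Inside the disc only `ω₋` can have nonzero order, on the circle only `ω₀`, outside only `ω₊`.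
The order of `X ^ κ` is the same for both triples and cancels. -/
theorem IsWienerHopfFactorization.unique {ω ωm ω₀ ωp ωm' ω₀' ωp' : RatFunc ℂ} (hω : ω ≠ 0)
    (h : IsWienerHopfFactorization ω ωm ω₀ ωp) (h' : IsWienerHopfFactorization ω ωm' ω₀' ωp') :
    ∃ cm c₀ cp : ℂ, cm * c₀ * cp = 1 ∧
      ωm' = RatFunc.C cm * ωm ∧ ω₀' = RatFunc.C c₀ * ω₀ ∧ ωp' = RatFunc.C cp * ωp := by
  obtain ⟨h1, h2, h3⟩ := h.factors_ne_zero hω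
  obtain ⟨h1', h2', h3'⟩ := h'.factors_ne_zero hω
  have key : ∀ z, ratOrd z ωm = ratOrd z ωm' ∧ ratOrd z ω₀ = ratOrd z ω₀' ∧
      ratOrd z ωp = ratOrd z ωp' := by
    intro z
    have e := h.ratOrd_eq hω z
    rw [h'.ratOrd_eq hω z] at e
    have m : 1 ≤ ‖z‖ → ratOrd z ωm = 0 ∧ ratOrd z ωm' = 0 := fun hz =>
      ⟨ratOrd_eq_zero (h.minus z hz).1 (h.minus z hz).2,
        ratOrd_eq_zero (h'.minus z hz).1 (h'.minus z hz).2⟩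
    have p : ‖z‖ ≤ 1 → ratOrd z ωp = 0 ∧ ratOrd z ωp' = 0 := fun hz =>
      ⟨ratOrd_eq_zero (h.plus z hz).1 (h.plus z hz).2,
        ratOrd_eq_zero (h'.plus z hz).1 (h'.plus z hz).2⟩
    have o : ‖z‖ ≠ 1 → ratOrd z ω₀ = 0 ∧ ratOrd z ω₀' = 0 := fun hz =>
      ⟨h.ratOrd_middle hz, h'.ratOrd_middle hz⟩
    rcases lt_trichotomy ‖z‖ 1 with hz | hz | hz
    · have := p hz.le; have := o hz.ne; omega
    · have := p hz.le; have := m hz.ge; omega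
    · have := m hz.le; have := o hz.ne'; omega
  obtain ⟨cm, -, em⟩ := exists_C_mul_of_ratOrd h1 h1' fun z => (key z).1
  obtain ⟨c₀, -, e₀⟩ := exists_C_mul_of_ratOrd h2 h2' fun z => (key z).2.1
  obtain ⟨cp, -, ep⟩ := exists_C_mul_of_ratOrd h3 h3' fun z => (key z).2.2
  refine ⟨cm, c₀, cp, ?_, em, e₀, ep⟩
  -- Both triples multiply to the same nonzero `ω`, so the product of the constants fixes `ω` and
  -- must be `1`.
  have e : RatFunc.C (cm * c₀ * cp) * ω = 1 * ω := by
    conv_lhs => rw [h.eq_mul]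
    conv_rhs => rw [h'.eq_mul, em, e₀, ep]
    rw [map_mul, map_mul]
    ring
  have := mul_right_cancel₀ hω e
  rw [← map_one (RatFunc.C (K := ℂ))] at this
  exact RatFunc.C_injective this

/-- The equality of degrees is not part of the definition of a factorization. It holds for the
constructed triple, and any other `ω₋` is a nonzero constant multiple of that one. -/
theorem IsWienerHopfFactorization.exists_isMinusQuotient {ω ωm ω₀ ωp : RatFunc ℂ} (hω : ω ≠ 0)
    (h : IsWienerHopfFactorization ω ωm ω₀ ωp) : ∃ a b : ℂ[X], IsMinusQuotient ωm a b := by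
  obtain ⟨ωm', ω₀', ωp', h', a, b, hab⟩ := exists_isWienerHopfFactorization hω
  obtain ⟨cm, c₀, cp, hc, rfl, -, -⟩ := h'.unique hω h
  refine ⟨_, b, hab.C_mul ?_⟩
  rintro rfl
  simp at hc

/-! ### Values on the circle; vanishing of Fourier coefficients under multiplication and division by
polynomials -/

theorem onCircle_mul (x y : RatFunc ℂ) :
    onCircle (x * y) =ᵐ[haarAddCircle] fun t => onCircle x t * onCircle y t := by
  filter_upwards [ae_eval_ne_zero x.denom_ne_zero, ae_eval_ne_zero y.denom_ne_zero] with t h1 h2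
  exact RatFunc.eval_mul (f := RingHom.id ℂ) (a := circlePt t) h1 h2

/-- `onCircle` evaluates the reduced fraction; off the finitely many zeros of the denominators any
other representation has the same values. -/
theorem onCircle_div (a : ℂ[X]) {b : ℂ[X]} (hb : b ≠ 0) :
    onCircle (algebraMap ℂ[X] (RatFunc ℂ) a / algebraMap ℂ[X] (RatFunc ℂ) b)
      =ᵐ[haarAddCircle] fun t => a.eval (circlePt t) / b.eval (circlePt t) := by
  set x := algebraMap ℂ[X] (RatFunc ℂ) a / algebraMap ℂ[X] (RatFunc ℂ) b with hx
  have e := congrArg (fun q t => q.eval (circlePt t))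
    ((RatFunc.num_mul_eq_mul_denom_iff (x := x) hb).2 hx)
  filter_upwards [ae_eval_ne_zero hb, ae_eval_ne_zero x.denom_ne_zero] with t h1 h2
  have := congrFun e t
  simp only [Polynomial.eval_mul] at this
  rw [onCircle_eq, div_eq_div_iff h2 h1, this]

/-- Integrable functions on the circle without Fourier coefficients of index `≥ m`. -/
def VanishesFrom (m : ℤ) (F : UnitAddCircle → ℂ) : Prop :=
  Integrable F haarAddCircle ∧ ∀ n : ℤ, m ≤ n → fourierCoeff F n = 0

theorem VanishesFrom.mono {m m' : ℤ} (hm : m ≤ m') {F : UnitAddCircle → ℂ}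
    (hF : VanishesFrom m F) : VanishesFrom m' F :=
  ⟨hF.1, fun n hn => hF.2 n (hm.trans hn)⟩

theorem VanishesFrom.congr {m : ℤ} {F G : UnitAddCircle → ℂ} (hF : VanishesFrom m F)
    (h : F =ᵐ[haarAddCircle] G) : VanishesFrom m G :=
  ⟨hF.1.congr h, fun n hn => by rw [← fourierCoeff_congr_ae h, hF.2 n hn]⟩

theorem VanishesFrom.add {m : ℤ} {F G : UnitAddCircle → ℂ} (hF : VanishesFrom m F)
    (hG : VanishesFrom m G) : VanishesFrom m fun t => F t + G t :=
  ⟨hF.1.add hG.1, fun n hn => by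
    rw [fourierCoeff_add' hF.1 hG.1, hF.2 n hn, hG.2 n hn, add_zero]⟩

theorem VanishesFrom.const_mul {m : ℤ} {F : UnitAddCircle → ℂ} (hF : VanishesFrom m F) (c : ℂ) :
    VanishesFrom m fun t => c * F t :=
  ⟨hF.1.const_mul c, fun n hn => by rw [fourierCoeff.const_mul, hF.2 n hn, mul_zero]⟩

theorem VanishesFrom.pow_mul {m : ℤ} {F : UnitAddCircle → ℂ} (hF : VanishesFrom m F) (k : ℕ) :
    VanishesFrom (m + k) fun t => circlePt t ^ k * F t := by
  induction k with
  | zero => simpa using hF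
  | succ k ih =>
    simp only [pow_succ', mul_assoc]
    refine ⟨integrable_circle_mul ih.1 continuous_circlePt, fun n hn => ?_⟩
    rw [fourierCoeff_pt_mul]
    exact ih.2 _ (by push_cast at hn; omega)

theorem VanishesFrom.poly_mul {m : ℤ} {F : UnitAddCircle → ℂ} (hF : VanishesFrom m F) (q : ℂ[X]) :
    VanishesFrom (m + q.natDegree) fun t => q.eval (circlePt t) * F t := by
  -- The induction is over sets of exponents with the bound `q.natDegree` kept fixed: in an
  -- induction over sums of polynomials, cancellation of leading terms could lower the degree.
  have : ∀ s : Finset ℕ, (∀ k ∈ s, k ≤ q.natDegree) → VanishesFrom (m + q.natDegree)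
      fun t => (∑ k ∈ s, q.coeff k * circlePt t ^ k) * F t := by
    intro s
    induction s using Finset.induction_on with
    | empty => exact fun _ => ⟨by simp, fun n _ => by simp [fourierCoeff_const']⟩
    | insert k s hk ih =>
      intro h
      simp only [Finset.sum_insert hk, add_mul, mul_assoc]
      refine VanishesFrom.add (((hF.pow_mul k).const_mul _).mono ?_)
        (ih fun j hj => h j (Finset.mem_insert_of_mem hj))
      have := h k (Finset.mem_insert_self k s)
      omega
  simpa only [← Polynomial.eval_eq_sum_range] using this (Finset.range (q.natDegree + 1))
    fun k hk => by simpa [Nat.lt_succ_iff] using hk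

/-- The hypothesis says that the coefficient of index `n - 1` is `α` times that of index `n` for all
`n > m`. As `‖α‖ ≤ 1`, the moduli do not decrease from `m` on, yet they tend to zero. The first
relation, `n = m + 1`, already reaches index `m`, so each linear factor removed lowers the threshold
by one. -/
theorem VanishesFrom.of_sub_mul {m : ℤ} {F : UnitAddCircle → ℂ} (hF : Integrable F haarAddCircle)
    {α : ℂ} (hα : ‖α‖ ≤ 1) (h : VanishesFrom (m + 1) fun t => (circlePt t - α) * F t) :
    VanishesFrom m F :=
  ⟨hF, coeff_forward hα fun n hn => by
    have := h.2 n (by omega)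
    rw [fourierCoeff_sub_mul hF] at this
    exact sub_eq_zero.1 this⟩

theorem VanishesFrom.of_prod_mul {m : ℤ} {F : UnitAddCircle → ℂ}
    (hF : Integrable F haarAddCircle) (s : Multiset ℂ) (hs : ∀ α ∈ s, ‖α‖ ≤ 1)
    (h : VanishesFrom (m + s.card) fun t => (s.map fun α => circlePt t - α).prod * F t) :
    VanishesFrom m F := by
  induction s using Multiset.induction_on generalizing m F with
  | empty => simpa using h
  | cons α s ih =>
    have hF' := integrable_circle_mul hF (φ := fun t => circlePt t - α)
      (continuous_circlePt.sub continuous_const)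
    refine VanishesFrom.of_sub_mul hF (hs α (Multiset.mem_cons_self α s))
      (ih hF' (fun β hβ => hs β (Multiset.mem_cons_of_mem hβ)) ?_)
    rw [Multiset.card_cons] at h
    push_cast at h
    rw [add_assoc, add_comm (1 : ℤ)]
    refine h.congr (ae_of_all _ fun t => ?_)
    simp only [Multiset.map_cons, Multiset.prod_cons]
    ring

theorem VanishesFrom.of_poly_mul {m : ℤ} {F : UnitAddCircle → ℂ}
    (hF : Integrable F haarAddCircle) {q : ℂ[X]} (hq : q ≠ 0) (hr : ∀ z, q.IsRoot z → ‖z‖ ≤ 1)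
    (h : VanishesFrom (m + q.natDegree) fun t => q.eval (circlePt t) * F t) :
    VanishesFrom m F := by
  have hlc : q.leadingCoeff ≠ 0 := Polynomial.leadingCoeff_ne_zero.2 hq
  refine VanishesFrom.of_prod_mul hF q.roots
    (fun α hα => hr α (Polynomial.isRoot_of_mem_roots hα)) ?_
  rw [← (IsAlgClosed.splits q).natDegree_eq_card_roots]
  refine (h.const_mul q.leadingCoeff⁻¹).congr (ae_of_all _ fun t => ?_)
  simp only
  rw [(IsAlgClosed.splits q).eval_eq_prod_roots]
  field_simp

/-- The mirror image of the division lemma for `VanishesFrom`: for roots with `1 ≤ ‖α‖` the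
recurrence is followed towards `-∞`. Here the threshold does not move, so no degrees enter. -/
theorem IsAnalyticFun.of_poly_mul {F : UnitAddCircle → ℂ} (hF : Integrable F haarAddCircle)
    {q : ℂ[X]} (hq : q ≠ 0) (hr : ∀ z, q.IsRoot z → 1 ≤ ‖z‖)
    (h : IsAnalyticFun fun t => q.eval (circlePt t) * F t) : IsAnalyticFun F := by
  have hlc : q.leadingCoeff ≠ 0 := Polynomial.leadingCoeff_ne_zero.2 hq
  have key : ∀ s : Multiset ℂ, (∀ α ∈ s, 1 ≤ ‖α‖) → ∀ G : UnitAddCircle → ℂ,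
      Integrable G haarAddCircle →
      (IsAnalyticFun fun t => (s.map fun α => circlePt t - α).prod * G t) →
      IsAnalyticFun G := by
    intro s
    induction s using Multiset.induction_on with
    | empty => exact fun _ G _ h => by simpa using h
    | cons α s ih =>
      intro hs G hG h
      have hG' := integrable_circle_mul hG (φ := fun t => circlePt t - α)
        (continuous_circlePt.sub continuous_const)
      have h1 := ih (fun β hβ => hs β (Multiset.mem_cons_of_mem hβ)) _ hG'
        (h.congr (ae_of_all _ fun t => by
          simp only [Multiset.map_cons, Multiset.prod_cons]
          ring))
      refine ⟨hG, coeff_backward (hs α (Multiset.mem_cons_self α s)) fun n hn => ?_⟩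
      have := h1.2 n hn
      rw [fourierCoeff_sub_mul hG] at this
      exact sub_eq_zero.1 this
  refine key q.roots (fun α hα => hr α (Polynomial.isRoot_of_mem_roots hα)) F hF ?_
  refine (h.poly_mul (Polynomial.C q.leadingCoeff⁻¹)).congr (ae_of_all _ fun t => ?_)
  simp only [Polynomial.eval_C]
  rw [(IsAlgClosed.splits q).eval_eq_prod_roots]
  field_simp

/-! ### Multiplication by quotients of polynomials on `L^p`, `H^p` and `K^p` -/

/-- Multiplication by the continuous function `a / b`, where the polynomial `b` has no zeros on
the circle. -/
noncomputable def mulQuotient (p : ℝ≥0∞) {a b : ℂ[X]} (hb : ∀ z, b.IsRoot z → ‖z‖ ≠ 1) :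
    LpCircle p →ₗ[ℂ] LpCircle p :=
  have hne : ∀ t, b.eval (circlePt t) ≠ 0 := fun t ht => hb _ ht (norm_circlePt t)
  have hc : Continuous fun t => a.eval (circlePt t) / b.eval (circlePt t) :=
    (continuous_polyPt a).div (continuous_polyPt b) hne
  { toFun := fun f => (memLp_circle_mul (Lp.memLp f) hc).toLp
    map_add' := fun f g => by
      refine Lp.ext ?_
      filter_upwards [(memLp_circle_mul (Lp.memLp (f + g)) hc).coeFn_toLp,
        (memLp_circle_mul (Lp.memLp f) hc).coeFn_toLp,
        (memLp_circle_mul (Lp.memLp g) hc).coeFn_toLp, Lp.coeFn_add f g,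
        Lp.coeFn_add (memLp_circle_mul (Lp.memLp f) hc).toLp
          (memLp_circle_mul (Lp.memLp g) hc).toLp] with t e1 e2 e3 e4 e5
      rw [e1, e5, Pi.add_apply, e2, e3, e4, Pi.add_apply, mul_add]
    map_smul' := fun c f => by
      refine Lp.ext ?_
      filter_upwards [(memLp_circle_mul (Lp.memLp (c • f)) hc).coeFn_toLp,
        (memLp_circle_mul (Lp.memLp f) hc).coeFn_toLp, Lp.coeFn_smul c f,
        Lp.coeFn_smul c (memLp_circle_mul (Lp.memLp f) hc).toLp] with t e1 e2 e3 e4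
      rw [e1, RingHom.id_apply, e4, Pi.smul_apply, e2, e3, Pi.smul_apply, smul_eq_mul,
        smul_eq_mul, mul_left_comm] }

theorem mulQuotient_ae {p : ℝ≥0∞} {a b : ℂ[X]} (hb : ∀ z, b.IsRoot z → ‖z‖ ≠ 1)
    (f : LpCircle p) : mulQuotient p (a := a) hb f =ᵐ[haarAddCircle]
      fun t => a.eval (circlePt t) / b.eval (circlePt t) * f t :=
  (memLp_circle_mul (Lp.memLp f) ((continuous_polyPt a).div (continuous_polyPt b)
    fun t ht => hb _ ht (norm_circlePt t))).coeFn_toLp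

theorem mulQuotient_mul_ae {p : ℝ≥0∞} {a b : ℂ[X]} (hb : ∀ z, b.IsRoot z → ‖z‖ ≠ 1)
    (f : LpCircle p) : (fun t => b.eval (circlePt t) * mulQuotient p (a := a) hb f t)
      =ᵐ[haarAddCircle] fun t => a.eval (circlePt t) * f t := by
  filter_upwards [mulQuotient_ae (a := a) hb f] with t e
  have : b.eval (circlePt t) ≠ 0 := fun ht => hb _ ht (norm_circlePt t)
  rw [e]
  field_simp

theorem mulQuotient_mem_hardySpace {p : ℝ≥0∞} [Fact (1 ≤ p)] {a b : ℂ[X]} (hb0 : b ≠ 0)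
    (hb : ∀ z, b.IsRoot z → ‖z‖ ≠ 1) (hb1 : ∀ z, b.IsRoot z → 1 ≤ ‖z‖) {f : LpCircle p}
    (hf : f ∈ hardySpace p) : mulQuotient p (a := a) hb f ∈ hardySpace p := by
  have h : IsAnalyticFun f := ⟨integrable_LpCircle f, hf⟩
  exact (IsAnalyticFun.of_poly_mul (integrable_LpCircle _) hb0 hb1
    ((h.poly_mul a).congr (mulQuotient_mul_ae hb f).symm)).2

/-- Multiplying by `a` raises the threshold of vanishing by at most `deg a`, and dividing by `b`
lowers it by `deg b`; the degree condition brings it back to `0`. -/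
theorem mulQuotient_mem_hardyCompl {p : ℝ≥0∞} [Fact (1 ≤ p)] {a b : ℂ[X]} (hb0 : b ≠ 0)
    (hb : ∀ z, b.IsRoot z → ‖z‖ ≠ 1) (hb1 : ∀ z, b.IsRoot z → ‖z‖ ≤ 1)
    (hab : a.natDegree ≤ b.natDegree) {f : LpCircle p} (hf : f ∈ hardyCompl p) :
    mulQuotient p (a := a) hb f ∈ hardyCompl p := by
  have h : VanishesFrom 0 f := ⟨integrable_LpCircle f, hf⟩
  exact (VanishesFrom.of_poly_mul (integrable_LpCircle _) hb0 hb1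
    (((h.poly_mul a).mono (by omega)).congr (mulQuotient_mul_ae hb f).symm)).2

/-! ### Partial fractions separating poles in the disc from poles on the circle -/

/-- A strictly proper rational function with all poles in the open disc is in `K^p`. -/
theorem exists_hardyCompl_of_degree_lt (p : ℝ≥0∞) [Fact (1 ≤ p)] {v b : ℂ[X]} (hb0 : b ≠ 0)
    (hb : ∀ z, b.IsRoot z → ‖z‖ < 1) (hdeg : v.degree < b.degree) :
    ∃ η ∈ hardyCompl p,
      η =ᵐ[haarAddCircle] fun t => v.eval (circlePt t) / b.eval (circlePt t) := by
  have hb' : ∀ z, b.IsRoot z → ‖z‖ ≠ 1 := fun z hz => (hb z hz).ne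
  have h1 : MemLp (fun _ : UnitAddCircle => (1 : ℂ)) p haarAddCircle := memLp_const 1
  have hη : mulQuotient p (a := v) hb' h1.toLp =ᵐ[haarAddCircle]
      fun t => v.eval (circlePt t) / b.eval (circlePt t) := by
    filter_upwards [mulQuotient_ae (a := v) hb' h1.toLp, h1.coeFn_toLp] with t e1 e2
    rw [e1, e2, mul_one]
  refine ⟨_, ?_, hη⟩
  -- The zero numerator is treated apart: if `b` is constant then `v = 0`, and the strict inequality
  -- fails for `natDegree`.
  by_cases hv : v = 0
  · intro n _
    rw [fourierCoeff_congr_ae hη]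
    simp [hv, fourierCoeff_const']
  have hlt : v.natDegree < b.natDegree := Polynomial.natDegree_lt_natDegree hv hdeg
  -- The constant `1` has coefficients vanishing from index `1`, so `v` has them vanishing from `1 +
  -- deg v ≤ deg b`. Strict properness absorbs the extra one, and division by `b` reaches threshold
  -- `0`.
  have hone : VanishesFrom 1 fun _ => (1 : ℂ) :=
    ⟨integrable_const _, fun n hn => by rw [fourierCoeff_const', if_neg (by omega)]⟩
  refine (VanishesFrom.of_poly_mul (integrable_LpCircle _) hb0 (fun z hz => (hb z hz).le)
    (((hone.poly_mul v).mono (by omega)).congr ?_)).2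
  filter_upwards [mulQuotient_mul_ae (a := v) hb' h1.toLp, h1.coeFn_toLp] with t e1 e2
  rw [e1, e2]

/-- Partial fractions. -/
theorem exists_partial_fractions {c b d : ℂ[X]} (hb : b ≠ 0) (hd : d ≠ 0) (hbd : IsCoprime b d)
    (hdeg : c.degree < b.degree + d.degree) :
    ∃ u v : ℂ[X], u.degree < d.degree ∧ v.degree < b.degree ∧ c = u * b + v * d := by
  obtain ⟨s, r, hsr⟩ := hbd
  -- Modulo `d`, the Bézout relation makes `s` an inverse of `b`, so `c * s` solves `u * b ≡ c`;
  -- reducing it modulo `d` gives the required degree.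
  have hdvd : d ∣ c - (c * s % d) * b := by
    have e := EuclideanDomain.div_add_mod (c * s) d
    refine ⟨c * r + (c * s / d) * b, ?_⟩
    linear_combination (-c) * hsr - b * e
  obtain ⟨v, hv⟩ := hdvd
  have hu : (c * s % d).degree < d.degree := EuclideanDomain.mod_lt _ hd
  refine ⟨c * s % d, v, hu, ?_, by linear_combination hv⟩
  have hb' : b.degree ≠ ⊥ := by simpa using hb
  have h1 : (d * v).degree < b.degree + d.degree := by
    rw [← hv]
    refine (Polynomial.degree_sub_le _ _).trans_lt (max_lt hdeg ?_)
    rw [Polynomial.degree_mul, add_comm]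
    exact WithBot.add_lt_add_left hb' hu
  rw [Polynomial.degree_mul, add_comm] at h1
  exact lt_of_add_lt_add_right h1

/-- `(a / b) ρ` is the sum of a function in `K^p` and a function in `Rat₀(𝕋)`. -/
theorem IsMinusQuotient.mul_RatT₀ (p : ℝ≥0∞) [Fact (1 ≤ p)] {x : RatFunc ℂ} {a b : ℂ[X]}
    (h : IsMinusQuotient x a b) {ρ : RatFunc ℂ} (hρ : ρ ∈ RatT₀) :
    ∃ η ∈ hardyCompl p, ∃ ρ' ∈ RatT₀, ∀ᵐ t ∂(haarAddCircle : Measure UnitAddCircle),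
      a.eval (circlePt t) / b.eval (circlePt t) * onCircle ρ t = η t + onCircle ρ' t := by
  have hcop : IsCoprime b ρ.denom := by
    refine (Polynomial.isCoprime_iff_aeval_ne_zero_of_isAlgClosed ℂ ℂ _ _).2 fun z => ?_
    by_contra! hz
    simp only [Polynomial.coe_aeval_eq_eval] at hz
    exact (h.denom_roots z hz.1).ne (hρ.1 z hz.2)
  -- Since `a` and `b` have the same degree, multiplication by `a / b` keeps `ρ` strictly proper,
  -- and no polynomial part appears.
  have hdeg : (a * ρ.num).degree < b.degree + ρ.denom.degree := by
    rw [Polynomial.degree_mul, Polynomial.degree_eq_natDegree h.num_ne_zero, h.natDegree_eq,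
      ← Polynomial.degree_eq_natDegree h.denom_ne_zero]
    exact WithBot.add_lt_add_left (by simpa using h.denom_ne_zero) hρ.2
  obtain ⟨u, v, hu, hv, e⟩ := exists_partial_fractions h.denom_ne_zero ρ.denom_ne_zero hcop hdeg
  obtain ⟨η, hη, eη⟩ := exists_hardyCompl_of_degree_lt p h.denom_ne_zero h.denom_roots hv
  refine ⟨η, hη, _, mem_RatT₀_of_eq ρ.denom_ne_zero hρ.1 hu rfl, ?_⟩
  filter_upwards [eη, onCircle_div u ρ.denom_ne_zero, ae_eval_ne_zero h.denom_ne_zero,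
    ae_eval_ne_zero ρ.denom_ne_zero] with t e1 e2 h1 h2
  have e' := congrArg (Polynomial.eval (circlePt t)) e
  simp only [Polynomial.eval_mul, Polynomial.eval_add] at e'
  rw [e1, e2, onCircle_eq]
  field_simp
  linear_combination e'

/-! ### Toeplitz values when the symbol is multiplied on the left or on the right -/

theorem IsMinusQuotient.denom_roots_ne {x : RatFunc ℂ} {a b : ℂ[X]} (h : IsMinusQuotient x a b) :
    ∀ z, b.IsRoot z → ‖z‖ ≠ 1 := fun z hz => (h.denom_roots z hz).ne

theorem IsMinusQuotient.onCircle_ae {x : RatFunc ℂ} {a b : ℂ[X]} (h : IsMinusQuotient x a b) :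
    onCircle x =ᵐ[haarAddCircle] fun t => a.eval (circlePt t) / b.eval (circlePt t) := by
  rw [h.eq_div]
  exact onCircle_div a h.denom_ne_zero

theorem IsMinusQuotient.mulQuotient_inv {p : ℝ≥0∞} {x : RatFunc ℂ} {a b : ℂ[X]}
    (h : IsMinusQuotient x a b) (f : LpCircle p) :
    mulQuotient p (a := a) h.denom_roots_ne (mulQuotient p (a := b) h.inv.denom_roots_ne f)
      = f := by
  refine Lp.ext ?_
  filter_upwards [mulQuotient_ae (a := b) h.inv.denom_roots_ne f,
    mulQuotient_ae (a := a) h.denom_roots_ne (mulQuotient p (a := b) h.inv.denom_roots_ne f),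
    ae_eval_ne_zero h.denom_ne_zero, ae_eval_ne_zero h.num_ne_zero] with t e1 e2 h1 h2
  rw [e2, e1]
  field_simp

theorem IsMinusQuotient.mulQuotient_mem {p : ℝ≥0∞} [Fact (1 ≤ p)] {x : RatFunc ℂ} {a b : ℂ[X]}
    (h : IsMinusQuotient x a b) {f : LpCircle p} (hf : f ∈ hardyCompl p) :
    mulQuotient p (a := a) h.denom_roots_ne f ∈ hardyCompl p :=
  mulQuotient_mem_hardyCompl h.denom_ne_zero _ (fun z hz => (h.denom_roots z hz).le)
    h.natDegree_eq.le hf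

theorem IsMinusQuotient.isToeplitzDecomp {p : ℝ≥0∞} [Fact (1 ≤ p)] {x : RatFunc ℂ} {a b : ℂ[X]}
    (h : IsMinusQuotient x a b) (g : hardySpace p) :
    IsToeplitzDecomp x g (mulQuotient p (a := a) h.denom_roots_ne g) 0 := by
  refine ⟨zero_mem_RatT₀, ?_⟩
  filter_upwards [h.onCircle_ae, mulQuotient_ae (a := a) h.denom_roots_ne (g : LpCircle p)]
    with t e1 e2
  rw [e1, e2]
  simp [onCircle]

/-- Multiplying the symbol by `a / b` transforms decompositions accordingly. -/
theorem IsToeplitzDecomp.minus_mul {p : ℝ≥0∞} [Fact (1 ≤ p)] {x ψ : RatFunc ℂ} {a b : ℂ[X]}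
    (h : IsMinusQuotient x a b) {g : hardySpace p} {f : LpCircle p} {ρ : RatFunc ℂ}
    (hf : IsToeplitzDecomp ψ g f ρ) : ∃ η ∈ hardyCompl p, ∃ ρ',
      IsToeplitzDecomp (x * ψ) g (mulQuotient p (a := a) h.denom_roots_ne f + η) ρ' := by
  obtain ⟨η, hη, ρ', hρ', e⟩ := h.mul_RatT₀ p hf.1
  refine ⟨η, hη, ρ', hρ', ?_⟩
  filter_upwards [e, hf.2, onCircle_mul x ψ, h.onCircle_ae,
    mulQuotient_ae (a := a) h.denom_roots_ne f,
    Lp.coeFn_add (mulQuotient p (a := a) h.denom_roots_ne f) η] with t e1 e2 e3 e4 e5 e6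
  rw [e3, e4, e6, Pi.add_apply, e5, mul_assoc, e2, mul_add, e1, add_assoc]

/-- Multiplication by `x` and by `x⁻¹` both preserve `K^p` and carry decompositions to
decompositions up to a term in `K^p`, which the Riesz projection does not see. The inverse is what
recovers a decomposition for `ψ` from one for `x * ψ`. -/
theorem isToeplitzValue_minus_mul_iff {p : ℝ≥0∞} [Fact (1 ≤ p)] {x ψ : RatFunc ℂ} {a b : ℂ[X]}
    (h : IsMinusQuotient x a b) (hx : x ≠ 0) {g k : hardySpace p} :
    IsToeplitzValue (x * ψ) g k ↔
      ∃ k' : hardySpace p, IsToeplitzValue ψ g k' ∧ IsToeplitzValue x k' k := by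
  let L := mulQuotient p (a := a) h.denom_roots_ne
  let L' := mulQuotient p (a := b) h.inv.denom_roots_ne
  constructor
  · rintro ⟨f, ρ, hf, hk⟩
    obtain ⟨η, hη, ρ', hd⟩ := hf.minus_mul h.inv
    rw [inv_mul_cancel_left₀ hx] at hd
    obtain ⟨k', hk'⟩ := hd.exists_isRieszProjection
    refine ⟨k', ⟨_, _, hd, hk'⟩, _, _, h.isToeplitzDecomp k', ?_⟩
    -- Using `L L' f = f`, the defect of `k` as a projection of `L k'` is written as a combination
    -- of three elements of `K^p`: the defect of `k` for `f`, and the images under `L` of `η` and of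
    -- the defect of `k'`.
    have e : mulQuotient p (a := a) h.denom_roots_ne k' - k = (f - k) + L η - L (L' f + η - k') := by
      have : L (L' f) = f := h.mulQuotient_inv f
      rw [map_sub, map_add, this]
      simp only [L]
      abel
    rw [IsRieszProjection, e]
    exact (hardyCompl p).sub_mem ((hardyCompl p).add_mem hk (h.mulQuotient_mem hη))
      (h.mulQuotient_mem hk')
  · rintro ⟨k', ⟨f', ρ', hf', hk'⟩, f'', ρ'', hf'', hk⟩
    -- The `L^p` part for `x` applied to `k'` can only be `L k'`, since that product is already in
    -- `L^p`.
    obtain rfl := hf''.unique (h.isToeplitzDecomp k')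
    obtain ⟨η, hη, ρ, hd⟩ := hf'.minus_mul h
    refine ⟨_, _, hd, ?_⟩
    have e : mulQuotient p (a := a) h.denom_roots_ne f' + η - k = L (f' - k') + η + (L k' - k) := by
      rw [map_sub]
      simp only [L]
      abel
    rw [IsRieszProjection, e]
    exact (hardyCompl p).add_mem ((hardyCompl p).add_mem (h.mulQuotient_mem hk') hη) hk

/-- Multiplication by `x` stays in `H^p`, so `T_x` is defined everywhere and is plain
multiplication, with zero remainder and trivial projection. Nothing has to be inverted, hence only
the poles of `x` matter here. -/
theorem isToeplitzValue_mul_plus_iff {p : ℝ≥0∞} [Fact (1 ≤ p)] {x ψ : RatFunc ℂ}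
    (hx : ∀ z, HasPoleAt x z → 1 < ‖z‖) {g k : hardySpace p} :
    IsToeplitzValue (ψ * x) g k ↔
      ∃ k' : hardySpace p, IsToeplitzValue x g k' ∧ IsToeplitzValue ψ k' k := by
  have hne : ∀ z, x.denom.IsRoot z → ‖z‖ ≠ 1 := fun z hz => (hx z hz).ne'
  let g' : hardySpace p := ⟨mulQuotient p (a := x.num) hne g,
    mulQuotient_mem_hardySpace x.denom_ne_zero hne (fun z hz => (hx z hz).le) g.2⟩
  have hg' : IsToeplitzValue x g g' := by
    refine ⟨g', 0, ⟨zero_mem_RatT₀, ?_⟩, ?_⟩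
    · filter_upwards [mulQuotient_ae (a := x.num) hne (g : LpCircle p)] with t e
      rw [e, onCircle_eq]
      simp [onCircle]
    · have := (hardyCompl p).zero_mem
      rwa [← sub_self (g' : LpCircle p)] at this
  have hiff : ∀ f ρ, IsToeplitzDecomp (ψ * x) g f ρ ↔ IsToeplitzDecomp ψ g' f ρ := by
    refine fun f ρ => and_congr_right fun _ => ?_
    refine eventually_congr ?_
    filter_upwards [onCircle_mul ψ x, mulQuotient_ae (a := x.num) hne (g : LpCircle p)]
      with t e1 e2
    rw [e1, e2, mul_assoc, ← onCircle_eq]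
  constructor
  · rintro ⟨f, ρ, hf, hk⟩
    exact ⟨g', hg', f, ρ, (hiff f ρ).1 hf, hk⟩
  · rintro ⟨k', hk', f, ρ, hf, hk⟩
    obtain rfl := hk'.unique hg'
    exact ⟨f, ρ, (hiff f ρ).2 hf, hk⟩

/-! ### From value relations to equality of unbounded operators -/

/-- `IsToeplitzValue` is the graph of `toeplitz`, and composition of graphs is exactly the product
on its natural domain. An equivalence of relations therefore yields equality of domains along with
equality of values. -/
theorem toeplitz_eq_unboundedProd {p : ℝ≥0∞} [Fact (1 ≤ p)] {x y w : RatFunc ℂ}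
    (h : ∀ g k : hardySpace p, IsToeplitzValue w g k ↔
      ∃ k' : hardySpace p, IsToeplitzValue y g k' ∧ IsToeplitzValue x k' k) :
    toeplitz p w = unboundedProd (toeplitz p x) (toeplitz p y) := by
  have hdom : ∀ {v : RatFunc ℂ} {g k : hardySpace p}, IsToeplitzValue v g k →
      g ∈ (toeplitz p v).domain := fun ⟨f, ρ, hf, _⟩ => ⟨f, ρ, hf⟩
  refine LinearPMap.ext ?_ ?_
  · ext g
    constructor
    · intro hg
      obtain ⟨k, hk⟩ := exists_isToeplitzValue hg
      obtain ⟨k', h1, h2⟩ := (h g k).1 hk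
      refine ⟨hdom h1, ?_⟩
      rw [(toeplitz_apply_eq_iff ⟨g, hdom h1⟩ k').2 h1]
      exact hdom h2
    · rintro ⟨h1, h2⟩
      exact hdom ((h g _).2 ⟨_, (toeplitz_apply_eq_iff ⟨g, h1⟩ _).1 rfl,
        (toeplitz_apply_eq_iff ⟨_, h2⟩ _).1 rfl⟩)
  · rintro g hg ⟨h1, h2⟩
    rw [toeplitz_apply_eq_iff, h]
    exact ⟨_, (toeplitz_apply_eq_iff ⟨g, h1⟩ _).1 rfl, (toeplitz_apply_eq_iff ⟨_, h2⟩ _).1 rfl⟩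

theorem IsWienerHopfFactorization.toeplitz_eq (p : ℝ≥0∞) [Fact (1 ≤ p)] {ω ωm ω₀ ωp : RatFunc ℂ}
    (hω : ω ≠ 0) (h : IsWienerHopfFactorization ω ωm ω₀ ωp) :
    toeplitz p ω =
      unboundedProd (toeplitz p ωm)
        (unboundedProd (toeplitz p (RatFunc.X ^ discIndex ω * ω₀)) (toeplitz p ωp)) := by
  obtain ⟨a, b, hab⟩ := h.exists_isMinusQuotient hω
  have hp : ∀ z, HasPoleAt ωp z → 1 < ‖z‖ := fun z hz => by
    by_contra hcon
    exact (h.plus z (not_lt.1 hcon)).1 hz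
  -- The product is collapsed from the inside: first `ω₊` is absorbed into the symbol on the right,
  -- then `ω₋` on the left, where the remaining symbol plays the role of `ψ`.
  rw [← toeplitz_eq_unboundedProd (w := RatFunc.X ^ discIndex ω * ω₀ * ωp)
      fun g k => isToeplitzValue_mul_plus_iff hp,
    ← toeplitz_eq_unboundedProd (w := ωm * (RatFunc.X ^ discIndex ω * ω₀ * ωp))
      fun g k => isToeplitzValue_minus_mul_iff hab (h.factors_ne_zero hω).1,
    ← mul_assoc, ← h.eq_mul]

end RatToeplitz

theorem lemmaL (p : ℝ≥0∞) [Fact (1 ≤ p)] (hp : 1 < p) (hp' : p < ⊤)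
    (ω : RatFunc ℂ) (hω : ω ≠ 0) :
    (∃ ωm ω₀ ωp : RatFunc ℂ, IsWienerHopfFactorization ω ωm ω₀ ωp) ∧
    (∀ ωm ω₀ ωp ωm' ω₀' ωp' : RatFunc ℂ,
      IsWienerHopfFactorization ω ωm ω₀ ωp → IsWienerHopfFactorization ω ωm' ω₀' ωp' →
        ∃ cm c₀ cp : ℂ, cm * c₀ * cp = 1 ∧
          ωm' = RatFunc.C cm * ωm ∧ ω₀' = RatFunc.C c₀ * ω₀ ∧ ωp' = RatFunc.C cp * ωp) ∧
    (∀ ωm ω₀ ωp : RatFunc ℂ, IsWienerHopfFactorization ω ωm ω₀ ωp →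
      toeplitz p ω =
        unboundedProd (toeplitz p ωm)
          (unboundedProd (toeplitz p (RatFunc.X ^ discIndex ω * ω₀)) (toeplitz p ωp))) := by
  obtain ⟨ωm, ω₀, ωp, h, -⟩ := exists_isWienerHopfFactorization hω
  exact ⟨⟨ωm, ω₀, ωp, h⟩, fun _ _ _ _ _ _ h₁ h₂ => h₁.unique hω h₂,
    fun _ _ _ h => h.toeplitz_eq p hω⟩
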